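/- Let $\mathcal L^\infty=\operatorname{colim}_I\mathcal L^\infty_I$ be the quasi-local C*-algebra over $\mathbb Z$ with local algebras $\mathcal L^\infty_I=\mathcal B(\ell^2(\mathbb N)^{\otimes I})$ for bounded intervals $I\subseteq\mathbb Z$; the colimit is that of C*-algebras along the maps $T\mapsto T\otimes 1$. For a bounded interval $I$ let $\mathcal L^\infty_{I^c}$ be the C*-subalgebra generated by the $\mathcal L^\infty_J$ with $J$ a bounded interval disjoint from $I$. A DHR bimodule of $\mathcal L^\infty$ is an $\mathcal L^\infty$-$\mathcal L^\infty$ correspondence $X$ (a right Hilbert C*-module over $\mathcal L^\infty$ with a unital left action of $\mathcal L^\infty$ by adjointable operators) such that for every sufficiently long bounded interval $I$ there is a finite projective basis $b_1,\dots,b_n$ of $X$ (that is, $x=\sum_i b_i\langle b_i\,|\,x\rangle$ for all $x\in X$) with $ab_i=b_ia$ for all $a\in\mathcal L^\infty_{I^c}$ and all $i$. With adjointable bimodule maps as morphisms and the relative tensor product $\boxtimes_{\mathcal L^\infty}$, the DHR bimodules form a C*-tensor category $\mathrm{DHR}(\mathcal L^\infty)$; let $\mathrm{DHR}_0(\mathcal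 L^\infty)$ be its full subcategory of dualizable objects. Its DHR braiding is the braiding that maps $x\boxtimes y$ to $y\boxtimes x$ whenever $x\in X$ commutes with $\mathcal L^\infty_{I^c}$ and $y\in Y$ commutes with $\mathcal L^\infty_{J^c}$ for bounded intervals $I,J$ with $J$ sufficiently far to the right of $I$ (how far may depend on $X$ and $Y$). Then: 1. For every $X\in\mathrm{DHR}_0(\mathcal L^\infty)$ there are an integer $k\ge 0$ and a unitary isomorphism of correspondences $X\cong(\mathcal L^\infty)^{\oplus k}$. 2. The DHR braiding on $\mathrm{DHR}_0(\mathcal L^\infty)$ exists, and there is a $\mathbb C$-linear unitary braided tensor equivalence $\mathrm{DHR}_0(\mathcal L^\infty)\cong\mathrm{Hilb}_{f.d.}$, where $\mathrm{Hilb}_{f.d.}$ is the category of finite-dimensional complex Hilbert spaces and linear maps with its usual tensor product, adjoint and flip braiding. -/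

import Mathlib

open scoped InnerProductSpace ENNReal TensorProduct
open CategoryTheory MulOpposite
noncomputable section
namespace RotorChain

/-- The Hilbert space `ℓ²(α)`. For a finite set `F` of sites, `ℓ²(F → ℕ)` is the Hilbert space tensor
power `ℓ²(ℕ)^{⊗F}`, with `e_{n₁} ⊗ ⋯ ⊗ e_{nₖ}` identified with `e_{(n₁, …, nₖ)}`. -/
abbrev L2 (α : Type) : Type := lp (fun _ : α => ℂ) 2

section Amplification
variable {α β γ : Type} (e : γ ≃ α × β)

/-- For `ℓ²(γ) = ℓ²(α) ⊗ ℓ²(β)`, the component `(1 ⊗ ⟨e_b|) ξ` of `ξ`. -/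
def slice (b : β) (ξ : L2 γ) : L2 α :=
  ⟨fun a => ξ (e.symm (a, b)), by
    have h := (memℓp_gen_iff (by norm_num : 0 < (2 : ℝ≥0∞).toReal)).1 (lp.memℓp ξ)
    exact (memℓp_gen_iff (by norm_num : 0 < (2 : ℝ≥0∞).toReal)).2
      (h.comp_injective (i := fun a => e.symm (a, b))
        (fun a a' haa => (Prod.ext_iff.1 (e.symm.injective haa)).1))⟩

theorem hasSum_inner_slice (ξ η : L2 γ) :
    HasSum (fun b => ⟪slice e b ξ, slice e b η⟫_ℂ) ⟪ξ, η⟫_ℂ := by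
  have h := lp.hasSum_inner (𝕜 := ℂ) ξ η
  have h' := ((Equiv.prodComm β α).trans e.symm).hasSum_iff.2 h
  exact h'.prod_fiberwise fun b => lp.hasSum_inner (𝕜 := ℂ) (slice e b ξ) (slice e b η)

theorem hasSum_norm_slice (ξ : L2 γ) :
    HasSum (fun b => ‖slice e b ξ‖ ^ 2) (‖ξ‖ ^ 2) := by
  have h := Complex.hasSum_re (hasSum_inner_slice e ξ ξ)
  simpa only [← RCLike.re_eq_complex_re, inner_self_eq_norm_sq] using h

theorem ampl_aux (S : L2 α →L[ℂ] L2 α) (ξ : L2 γ) :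
    HasSum (fun c => ‖S (slice e (e c).2 ξ) (e c).1‖ ^ 2) (∑' b, ‖S (slice e b ξ)‖ ^ 2) := by
  have hs : Summable (fun b => ‖S (slice e b ξ)‖ ^ 2) :=
    Summable.of_nonneg_of_le (fun _ => by positivity)
      (fun b => by
        calc ‖S (slice e b ξ)‖ ^ 2 ≤ (‖S‖ * ‖slice e b ξ‖) ^ 2 := by
              gcongr; exact S.le_opNorm _
          _ = ‖S‖ ^ 2 * ‖slice e b ξ‖ ^ 2 := by ring)
      ((hasSum_norm_slice e ξ).summable.mul_left (‖S‖ ^ 2))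
  have hf : ∀ b, HasSum (fun a => ‖S (slice e b ξ) a‖ ^ 2) (‖S (slice e b ξ)‖ ^ 2) := fun b => by
    have := lp.hasSum_norm (by norm_num : 0 < (2 : ℝ≥0∞).toReal) (S (slice e b ξ))
    simpa using this
  rw [← ((Equiv.prodComm β α).trans e.symm).hasSum_iff]
  have hsum : Summable (fun p : β × α => ‖S (slice e p.1 ξ) p.2‖ ^ 2) := by
    rw [summable_prod_of_nonneg (fun _ => by positivity)]
    exact ⟨fun b => (hf b).summable, by simpa only [(hf _).tsum_eq] using hs⟩
  have := hsum.hasSum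
  rw [hsum.tsum_prod' fun b => (hf b).summable] at this
  simp only [(hf _).tsum_eq] at this
  simpa [Function.comp_def] using this

/-- `(S ⊗ 1) ξ`. -/
def amplFun (S : L2 α →L[ℂ] L2 α) (ξ : L2 γ) : L2 γ :=
  ⟨fun c => S (slice e (e c).2 ξ) (e c).1,
    (memℓp_gen_iff (by norm_num : 0 < (2 : ℝ≥0∞).toReal)).2
      (by simpa using (ampl_aux e S ξ).summable)⟩

theorem slice_amplFun (S : L2 α →L[ℂ] L2 α) (ξ : L2 γ) (b : β) :
    slice e b (amplFun e S ξ) = S (slice e b ξ) := by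
  ext a; simp [slice, amplFun]

theorem ext_slice {ξ η : L2 γ} (h : ∀ b, slice e b ξ = slice e b η) : ξ = η := by
  ext c
  have := congrArg (fun f : L2 α => f (e c).1) (h (e c).2)
  simpa [slice] using this

theorem slice_add (b : β) (ξ η : L2 γ) : slice e b (ξ + η) = slice e b ξ + slice e b η := rfl
theorem slice_smul (b : β) (z : ℂ) (ξ : L2 γ) : slice e b (z • ξ) = z • slice e b ξ := rfl

/-- The bounded operator `S ⊗ 1` on `ℓ²(γ) = ℓ²(α) ⊗ ℓ²(β)`. -/
def amplCLM (S : L2 α →L[ℂ] L2 α) : L2 γ →L[ℂ] L2 γ :=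
  LinearMap.mkContinuous
    { toFun := amplFun e S
      map_add' := fun ξ η => ext_slice e fun b => by simp [slice_amplFun, slice_add]
      map_smul' := fun z ξ => ext_slice e fun b => by simp [slice_amplFun, slice_smul] }
    ‖S‖ fun ξ => by
      refine le_of_sq_le_sq ?_ (by positivity) 
      have h1 := hasSum_norm_slice e (amplFun e S ξ)
      have h2 := (hasSum_norm_slice e ξ).mul_left (‖S‖ ^ 2)
      rw [mul_pow]
      refine hasSum_le (fun b => ?_) h1 h2
      rw [slice_amplFun, ← mul_pow]
      gcongr; exact S.le_opNorm _

theorem slice_amplCLM (S : L2 α →L[ℂ] L2 α) (ξ : L2 γ) (b : β) :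
    slice e b (amplCLM e S ξ) = S (slice e b ξ) := slice_amplFun e S ξ b

/-- The amplification `S ↦ S ⊗ 1`, `B(ℓ²(α)) → B(ℓ²(γ))`, for an identification `γ ≃ α × β`. -/
def ampl : (L2 α →L[ℂ] L2 α) →⋆ₐ[ℂ] (L2 γ →L[ℂ] L2 γ) where
  toFun := amplCLM e
  map_one' := by ext1 ξ; exact ext_slice e fun b => by simp [slice_amplCLM]
  map_mul' S T := by ext1 ξ; exact ext_slice e fun b => by simp [slice_amplCLM]
  map_zero' := by ext1 ξ; exact ext_slice e fun b => by rw [slice_amplCLM]; rfl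
  map_add' S T := by ext1 ξ; exact ext_slice e fun b => by simp [slice_amplCLM, slice_add]
  commutes' z := by
    ext1 ξ
    exact ext_slice e fun b => by
      simp [slice_amplCLM, slice_smul, Algebra.algebraMap_eq_smul_one]
  map_star' S := by
    rw [ContinuousLinearMap.star_eq_adjoint, ContinuousLinearMap.star_eq_adjoint,
      ContinuousLinearMap.eq_adjoint_iff]
    intro ξ η
    refine (hasSum_inner_slice e _ _).unique ?_
    simpa only [slice_amplCLM, ContinuousLinearMap.adjoint_inner_left] using
      hasSum_inner_slice e ξ (amplCLM e S η)

end Amplification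

/-- Configurations `ℤ → ℕ` that vanish at all but finitely many sites: `ℓ²(Config)` is the infinite
tensor product of copies of `ℓ²(ℕ)` along the unit vectors `e_0`. -/
abbrev Config : Type := ℤ →₀ ℕ

/-- A configuration is a pair of a configuration on `F` and one on the complement of `F`. -/
def splitConfig (F : Finset ℤ) : Config ≃ (F → ℕ) × ({i : ℤ // i ∉ F} →₀ ℕ) where
  toFun n := (fun i => n i, n.subtypeDomain (· ∉ F))
  invFun p := Finsupp.indicator F (fun i hi => p.1 ⟨i, hi⟩) + p.2.extendDomain
  left_inv n := by
    classical
    ext i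
    by_cases hi : i ∈ F <;> simp [Finsupp.extendDomain, hi]
  right_inv p := by
    classical
    ext i
    · simp [Finsupp.extendDomain]
    · simp [Finsupp.extendDomain, i.2]

/-- The algebra `B(ℓ²(ℕ)^{⊗F}) ⊗ 1` of operators localized in `F`. -/
def localOp (F : Finset ℤ) : StarSubalgebra ℂ (L2 Config →L[ℂ] L2 Config) :=
  (ampl (splitConfig F)).range

/-- The C*-algebra generated by all operators localized in bounded intervals. The maps
`B(ℓ²(ℕ)^{⊗I}) → B(ℓ²(Config))`, `S ↦ S ⊗ 1`, are injective *-homomorphisms compatible with the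
inclusions `B(ℓ²(ℕ)^{⊗I}) → B(ℓ²(ℕ)^{⊗J})`, `I ⊆ J`, so that this is the C*-algebraic colimit of the
local algebras. -/
def quasiLocal : StarSubalgebra ℂ (L2 Config →L[ℂ] L2 Config) :=
  (⨆ (p : ℤ) (q : ℤ), localOp (Finset.Icc p q)).topologicalClosure

/-- The quasi-local C*-algebra `L^∞ = colim_I B(ℓ²(ℕ)^{⊗I})`. -/
def LInf : Type := quasiLocal

instance : CStarAlgebra LInf :=
  haveI : IsClosed (quasiLocal : Set (L2 Config →L[ℂ] L2 Config)) :=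
    StarSubalgebra.isClosed_topologicalClosure _
  inferInstanceAs (CStarAlgebra quasiLocal)

instance : PartialOrder LInf := CStarAlgebra.spectralOrder LInf
instance : StarOrderedRing LInf := CStarAlgebra.spectralOrderedRing LInf

/-- The defining representation of `L^∞`. -/
def LInf.incl : LInf →⋆ₐ[ℂ] (L2 Config →L[ℂ] L2 Config) := quasiLocal.subtype

/-- The local algebra `L^∞_F ≅ B(ℓ²(ℕ)^{⊗F})` as a subalgebra of `L^∞`. -/
def LInf.loc (F : Finset ℤ) : StarSubalgebra ℂ LInf := (localOp F).comap LInf.incl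

section Corr

variable (A : Type) [CStarAlgebra A] [PartialOrder A] [StarOrderedRing A]

/-- An `A`-`A` correspondence: a right Hilbert C*-module over `A` (complete with respect to the norm
`‖x‖ = ‖⟨x, x⟩‖^{1/2}`), with a unital left action of `A` by adjointable operators.
`lact a x` is `a x` and `ract (op a) x` is `x a`; the inner product is linear in its second
variable. -/
structure Corr where
  carrier : Type
  [addCommGroup : AddCommGroup carrier]
  [module : Module ℂ carrier]
  lact : A →ₐ[ℂ] Module.End ℂ carrier
  ract : Aᵐᵒᵖ →ₐ[ℂ] Module.End ℂ carrier
  lact_ract : ∀ a b x, lact a (ract b x) = ract b (lact a x)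
  inner : carrier →ₗ⋆[ℂ] carrier →ₗ[ℂ] A
  inner_ract : ∀ x y a, inner x (ract (op a) y) = inner x y * a
  star_inner : ∀ x y, star (inner x y) = inner y x
  inner_self_nonneg : ∀ x, 0 ≤ inner x x
  inner_self_eq_zero : ∀ x, inner x x = 0 → x = 0
  inner_lact : ∀ a x y, inner (lact a x) y = inner x (lact (star a) y)
  complete : ∀ u : ℕ → carrier,
    (∀ ε > 0, ∃ N, ∀ m ≥ N, ∀ n ≥ N, √‖inner (u m - u n) (u m - u n)‖ < ε) →
    ∃ x, ∀ ε > 0, ∃ N, ∀ n ≥ N, √‖inner (u n - x) (u n - x)‖ < ε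

attribute [instance] Corr.addCommGroup Corr.module

variable {A}

/-- Finite projective bases: `x = ∑ i, b i ⟨b i, x⟩` for all `x`. -/
def IsProjBasis {V : Type} [AddCommGroup V] [Module ℂ V] (r : Aᵐᵒᵖ →ₐ[ℂ] Module.End ℂ V)
    (ip : V →ₗ⋆[ℂ] V →ₗ[ℂ] A) {n : ℕ} (b : Fin n → V) : Prop :=
  ∀ x, x = ∑ i, r (op (ip (b i) x)) (b i)

/-- Completeness is automatic if there is a finite projective basis. -/
theorem complete_of_basis {V : Type} [AddCommGroup V] [Module ℂ V]
    (r : Aᵐᵒᵖ →ₐ[ℂ] Module.End ℂ V) (ip : V →ₗ⋆[ℂ] V →ₗ[ℂ] A)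
    (hr : ∀ x y a, ip x (r (op a) y) = ip x y * a)
    (hs : ∀ x y, star (ip x y) = ip y x)
    {n : ℕ} {b : Fin n → V} (hb : IsProjBasis r ip b) (u : ℕ → V)
    (hu : ∀ ε > 0, ∃ N, ∀ m ≥ N, ∀ n ≥ N, √‖ip (u m - u n) (u m - u n)‖ < ε) :
    ∃ x, ∀ ε > 0, ∃ N, ∀ n ≥ N, √‖ip (u n - x) (u n - x)‖ < ε := by
  have key : ∀ x i, ‖ip (b i) x‖ ≤ √‖ip x x‖ := by
    intro x i
    have h1 : ip x x = ∑ j, star (ip (b j) x) * ip (b j) x := by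
      conv_lhs => rw [hb x, map_sum]
      rw [← hb x]
      exact Finset.sum_congr rfl fun j _ => by rw [hr, hs]
    have h2 : star (ip (b i) x) * ip (b i) x ≤ ip x x := by
      rw [h1]
      exact Finset.single_le_sum (f := fun j => star (ip (b j) x) * ip (b j) x)
        (fun j _ => star_mul_self_nonneg _) (Finset.mem_univ i)
    have h3 := CStarAlgebra.norm_le_norm_of_nonneg_of_le (star_mul_self_nonneg _) h2
    rw [CStarRing.norm_star_mul_self] at h3
    exact Real.le_sqrt_of_sq_le (by rw [sq]; exact h3)
  have hc : ∀ i, ∃ a, Filter.Tendsto (fun k => ip (b i) (u k)) Filter.atTop (nhds a) := by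
    intro i
    refine cauchySeq_tendsto_of_complete (Metric.cauchySeq_iff.2 fun ε hε => ?_)
    obtain ⟨N, hN⟩ := hu ε hε
    refine ⟨N, fun m hm k hk => ?_⟩
    rw [dist_eq_norm, ← map_sub]
    exact (key _ i).trans_lt (hN m hm k hk)
  choose a ha using hc
  refine ⟨∑ i, r (op (a i)) (b i), ?_⟩
  have hform : ∀ k, ip (u k - ∑ i, r (op (a i)) (b i)) (u k - ∑ i, r (op (a i)) (b i)) =
      ∑ i, ∑ j, star (ip (b j) (u k) - a j) * ip (b j) (b i) * (ip (b i) (u k) - a i) := by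
    intro k
    have : u k - ∑ i, r (op (a i)) (b i) = ∑ i, r (op (ip (b i) (u k) - a i)) (b i) := by
      conv_lhs => rw [hb (u k)]
      rw [← Finset.sum_sub_distrib]
      exact Finset.sum_congr rfl fun i _ => by rw [MulOpposite.op_sub, map_sub, LinearMap.sub_apply]
    rw [this, map_sum]
    refine Finset.sum_congr rfl fun i _ => ?_
    rw [hr, ← hs, map_sum, star_sum, Finset.sum_mul]
    exact Finset.sum_congr rfl fun j _ => by rw [hr, star_mul, hs]
  have hlim : Filter.Tendsto (fun k => √‖ip (u k - ∑ i, r (op (a i)) (b i))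
      (u k - ∑ i, r (op (a i)) (b i))‖) Filter.atTop (nhds 0) := by
    simp_rw [hform]
    have h0 : ∀ i, Filter.Tendsto (fun k => ip (b i) (u k) - a i) Filter.atTop (nhds 0) :=
      fun i => by simpa using (ha i).sub_const (a i)
    have : Filter.Tendsto (fun k => ∑ i, ∑ j, star (ip (b j) (u k) - a j) * ip (b j) (b i) *
        (ip (b i) (u k) - a i)) Filter.atTop (nhds (∑ i : Fin n, ∑ j : Fin n,
          star 0 * ip (b j) (b i) * 0)) :=
      tendsto_finsetSum _ fun i _ => tendsto_finsetSum _ fun j _ =>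
        (((h0 j).star).mul_const _).mul (h0 i)
    simpa using (this.norm).sqrt
  intro ε hε
  obtain ⟨N, hN⟩ := Metric.tendsto_atTop.1 hlim ε hε
  exact ⟨N, fun k hk => by
    have := hN k hk
    rw [Real.dist_0_eq_abs] at this
    exact (le_abs_self _).trans_lt this⟩

variable (A) in
/-- Correspondences that have a finite projective basis. -/
structure FGCorr extends Corr A where
  exists_basis : ∃ (n : ℕ) (b : Fin n → carrier), IsProjBasis ract inner b

namespace FGCorr

instance : CoeSort (FGCorr A) Type := ⟨fun X => X.carrier⟩

variable (X Y Z W : FGCorr A)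

/-- Morphisms of correspondences: adjointable bimodule maps. -/
def homSubmodule : Submodule ℂ (X →ₗ[ℂ] Y) where
  carrier := {f | (∀ a x, f (X.lact a x) = Y.lact a (f x)) ∧
    (∀ a x, f (X.ract a x) = Y.ract a (f x)) ∧
    ∃ g : Y → X, ∀ x y, Y.inner (f x) y = X.inner x (g y)}
  zero_mem' := ⟨by simp, by simp, fun _ => 0, by simp⟩
  add_mem' := by
    rintro f f' ⟨h1, h2, g, h3⟩ ⟨h1', h2', g', h3'⟩
    exact ⟨by simp [h1, h1'], by simp [h2, h2'], fun y => g y + g' y, by simp [h3, h3']⟩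
  smul_mem' := by
    rintro z f ⟨h1, h2, g, h3⟩
    exact ⟨by simp [h1], by simp [h2], fun y => star z • g y, by simp [h3]⟩

variable {X Y Z W}

/-- Right linear maps are adjointable if there is a finite projective basis. -/
theorem adjointable (f : X →ₗ[ℂ] Y) (hr : ∀ a x, f (X.ract a x) = Y.ract a (f x)) :
    ∃ g : Y → X, ∀ x y, Y.inner (f x) y = X.inner x (g y) := by
  obtain ⟨n, b, hb⟩ := X.exists_basis
  refine ⟨fun y => ∑ i, X.ract (op (Y.inner (f (b i)) y)) (b i), fun x y => ?_⟩
  conv_lhs => rw [hb x]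
  simp only [map_sum, LinearMap.sum_apply, X.inner_ract, hr]
  refine Finset.sum_congr rfl fun i _ => ?_
  rw [← Y.star_inner, Y.inner_ract, star_mul, X.star_inner, Y.star_inner]

instance : Category (FGCorr A) where
  Hom X Y := ↥(homSubmodule X Y)
  id X := ⟨LinearMap.id, fun _ _ => rfl, fun _ _ => rfl, id, fun _ _ => rfl⟩
  comp {X Y Z} f g := ⟨g.1 ∘ₗ f.1, fun a x => by simp [f.2.1, g.2.1],
    fun a x => by simp [f.2.2.1, g.2.2.1], by
      obtain ⟨f', hf⟩ := f.2.2.2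
      obtain ⟨g', hg⟩ := g.2.2.2
      exact ⟨fun z => f' (g' z), fun x z => by simp [hf, hg]⟩⟩

/-- A morphism from a bimodule map. -/
def mkHom (f : X →ₗ[ℂ] Y) (hl : ∀ a x, f (X.lact a x) = Y.lact a (f x))
    (hr : ∀ a x, f (X.ract a x) = Y.ract a (f x)) : X ⟶ Y :=
  ⟨f, hl, hr, adjointable f hr⟩

/-- The linear map underlying a morphism. -/
def Hom.lin (f : X ⟶ Y) : X →ₗ[ℂ] Y := f.1

theorem hom_ext {f g : X ⟶ Y} (h : ∀ x, Hom.lin f x = Hom.lin g x) : f = g :=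
  Subtype.ext (LinearMap.ext h)

theorem lin_lact (f : X ⟶ Y) (a : A) (x : X) :
  Hom.lin f (X.lact a x) = Y.lact a (Hom.lin f x) := f.2.1 a x
theorem lin_ract (f : X ⟶ Y) (a : Aᵐᵒᵖ) (x : X) :
  Hom.lin f (X.ract a x) = Y.ract a (Hom.lin f x) := f.2.2.1 a x
@[simp] theorem lin_id (x : X) : Hom.lin (𝟙 X) x = x := rfl
@[simp] theorem lin_comp (f : X ⟶ Y) (g : Y ⟶ Z) (x : X) :
  Hom.lin (f ≫ g) x = Hom.lin g (Hom.lin f x) := rfl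
@[simp] theorem lin_mkHom (f : X →ₗ[ℂ] Y) (hl hr) (x : X) :
  Hom.lin (mkHom f hl hr) x = f x := rfl

instance (X Y : FGCorr A) : AddCommGroup (X ⟶ Y) := inferInstanceAs (AddCommGroup ↥(homSubmodule X Y))
instance (X Y : FGCorr A) : Module ℂ (X ⟶ Y) := inferInstanceAs (Module ℂ ↥(homSubmodule X Y))

theorem lin_add (f g : X ⟶ Y) (x : X) : Hom.lin (f + g) x = Hom.lin f x + Hom.lin g x := rfl
theorem lin_smul (z : ℂ) (f : X ⟶ Y) (x : X) : Hom.lin (z • f) x = z • Hom.lin f x := rfl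

instance : Preadditive (FGCorr A) where
  add_comp _ _ _ f f' g := hom_ext fun x => by simp [lin_add]
  comp_add _ _ _ f f' g := hom_ext fun x => by simp [lin_add]

instance : Linear ℂ (FGCorr A) where
  smul_comp _ _ _ z f g := hom_ext fun x => by simp [lin_smul]
  comp_smul _ _ _ f z g := hom_ext fun x => by simp [lin_smul]

theorem ext_inner {x x' : X} (h : ∀ y, X.inner y x = X.inner y x') : x = x' := by
  rw [← sub_eq_zero]
  apply X.inner_self_eq_zero
  rw [map_sub, h, sub_self]

/-- The adjoint of a morphism. -/
def dag (f : X ⟶ Y) : Y ⟶ X :=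
  have hg := f.2.2.2.choose_spec
  mkHom
    { toFun := f.2.2.2.choose
      map_add' := fun y y' => ext_inner fun x => by rw [map_add, ← hg, ← hg, ← hg, map_add]
      map_smul' := fun z y => ext_inner fun x => by
        rw [RingHom.id_apply, map_smul, ← hg, ← hg, map_smul] }
    (fun a y => ext_inner fun x => by
      have := X.inner_lact (star a) x (f.2.2.2.choose y)
      rw [star_star] at this
      change X.inner x (f.2.2.2.choose (Y.lact a y)) = X.inner x (X.lact a (f.2.2.2.choose y))
      rw [← this, ← hg, ← hg, f.2.1, Y.inner_lact, star_star])
    (fun a y => ext_inner fun x => by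
      obtain ⟨a, rfl⟩ := MulOpposite.op_surjective a
      change X.inner x (f.2.2.2.choose (Y.ract (op a) y)) =
        X.inner x (X.ract (op a) (f.2.2.2.choose y))
      rw [X.inner_ract, ← hg, ← hg, Y.inner_ract])

theorem inner_dag (f : X ⟶ Y) (x : X) (y : Y) :
    Y.inner (Hom.lin f x) y = X.inner x (Hom.lin (dag f) y) :=
  f.2.2.2.choose_spec x y

section Tensor

variable (X Y : FGCorr A)

/-- The relations `x a ⊗ y = x ⊗ a y`. -/
def balRel : Submodule ℂ (X ⊗[ℂ] Y) :=
  Submodule.span ℂ {t | ∃ (x : X) (a : A) (y : Y),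
    t = X.ract (op a) x ⊗ₜ[ℂ] y - x ⊗ₜ[ℂ] Y.lact a y}

/-- The relative tensor product `X ⊗_A Y`. For correspondences with finite projective bases it is
already separated and complete for the inner product
`⟨x ⊗ y, x' ⊗ y'⟩ = ⟨y, ⟨x, x'⟩ y'⟩` (see `Bal.inner_tmul` and `tensor`), hence it is the tensor
product of correspondences. -/
abbrev Bal : Type := (X ⊗[ℂ] Y) ⧸ balRel X Y

variable {X Y}

/-- Simple tensors. -/
def tmul (x : X) (y : Y) : Bal X Y := (balRel X Y).mkQ (x ⊗ₜ[ℂ] y)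

theorem ract_tmul (x : X) (a : A) (y : Y) : tmul (X.ract (op a) x) y = tmul x (Y.lact a y) := by
  rw [← sub_eq_zero, tmul, tmul, ← map_sub, Submodule.mkQ_apply, Submodule.Quotient.mk_eq_zero]
  exact Submodule.subset_span ⟨x, a, y, rfl⟩

theorem add_tmul (x x' : X) (y : Y) : tmul (x + x') y = tmul x y + tmul x' y := by
  simp only [tmul, TensorProduct.add_tmul, map_add]
theorem tmul_add (x : X) (y y' : Y) : tmul x (y + y') = tmul x y + tmul x y' := by
  simp only [tmul, TensorProduct.tmul_add, map_add]
theorem smul_tmul (z : ℂ) (x : X) (y : Y) : tmul (z • x) y = z • tmul x y := by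
  rw [tmul, tmul, ← TensorProduct.smul_tmul', map_smul]
theorem tmul_smul (z : ℂ) (x : X) (y : Y) : tmul x (z • y) = z • tmul x y := by
  simp only [tmul, TensorProduct.tmul_smul, map_smul]

variable (X Y) in
/-- The bilinear map `(x, y) ↦ x ⊗ y`. -/
def tmulₗ : X →ₗ[ℂ] Y →ₗ[ℂ] Bal X Y :=
  LinearMap.mk₂ ℂ tmul add_tmul smul_tmul tmul_add tmul_smul

theorem sum_tmul {n : ℕ} (x : Fin n → X) (y : Y) :
    tmul (∑ i, x i) y = ∑ i, tmul (x i) y :=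
  LinearMap.map_sum₂ (tmulₗ X Y) Finset.univ x y
theorem tmul_sum {n : ℕ} (x : X) (y : Fin n → Y) :
    tmul x (∑ i, y i) = ∑ i, tmul x (y i) :=
  map_sum (tmulₗ X Y x) y Finset.univ

@[elab_as_elim]
theorem Bal.induction {p : Bal X Y → Prop} (t : Bal X Y) (h1 : ∀ x y, p (tmul x y))
    (h2 : ∀ t t', p t → p t' → p (t + t')) : p t := by
  obtain ⟨t, rfl⟩ := (balRel X Y).mkQ_surjective t
  induction t with
  | zero => simpa [tmul] using h1 0 0
  | tmul x y => exact h1 x y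
  | add t t' ht ht' => rw [map_add]; exact h2 _ _ ht ht'

/-- The linear map induced by a balanced bilinear map. -/
def Bal.lift {V : Type} [AddCommGroup V] [Module ℂ V] (f : X →ₗ[ℂ] Y →ₗ[ℂ] V)
    (hf : ∀ x a y, f (X.ract (op a) x) y = f x (Y.lact a y)) : Bal X Y →ₗ[ℂ] V :=
  (balRel X Y).liftQ (TensorProduct.lift f) <| by
    refine Submodule.span_le.2 ?_
    rintro _ ⟨x, a, y, rfl⟩
    simp [hf]

@[simp] theorem Bal.lift_tmul {V : Type} [AddCommGroup V] [Module ℂ V] (f : X →ₗ[ℂ] Y →ₗ[ℂ] V)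
    (hf : ∀ x a y, f (X.ract (op a) x) y = f x (Y.lact a y)) (x : X) (y : Y) :
    Bal.lift f hf (tmul x y) = f x y := rfl

theorem Bal.lin_ext {V : Type} [AddCommGroup V] [Module ℂ V] {f g : Bal X Y →ₗ[ℂ] V}
    (h : ∀ x y, f (tmul x y) = g (tmul x y)) (t : Bal X Y) : f t = g t := by
  induction t using Bal.induction with
  | h1 x y => exact h x y
  | h2 t t' ht ht' => rw [map_add, map_add, ht, ht']

/-- The map `f ⊗ g`. -/
def Bal.map {X' Y' : FGCorr A} (f : X →ₗ[ℂ] X') (g : Y →ₗ[ℂ] Y')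
    (hf : ∀ a x, f (X.ract a x) = X'.ract a (f x))
    (hg : ∀ a y, g (Y.lact a y) = Y'.lact a (g y)) : Bal X Y →ₗ[ℂ] Bal X' Y' :=
  Bal.lift ((tmulₗ X' Y').compl₁₂ f g) fun x a y => by
    change tmul (f _) (g y) = tmul (f x) (g _)
    rw [hf, hg, ract_tmul]

@[simp] theorem Bal.map_tmul {X' Y' : FGCorr A} (f : X →ₗ[ℂ] X') (g : Y →ₗ[ℂ] Y') (hf hg)
    (x : X) (y : Y) : Bal.map f g hf hg (tmul x y) = tmul (f x) (g y) := rfl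

variable (X Y) in
/-- `a (x ⊗ y) = a x ⊗ y`. -/
def Bal.lact : A →ₐ[ℂ] Module.End ℂ (Bal X Y) where
  toFun a := Bal.map (X.lact a) LinearMap.id (fun b x => X.lact_ract a b x) (fun _ _ => rfl)
  map_one' := LinearMap.ext <| Bal.lin_ext fun x y => by simp
  map_mul' a b := LinearMap.ext <| Bal.lin_ext fun x y => by simp
  map_zero' := LinearMap.ext <| Bal.lin_ext fun x y => by
    simpa using smul_tmul 0 (0 : X) y
  map_add' a b := LinearMap.ext <| Bal.lin_ext fun x y => by simp [add_tmul]
  commutes' z := LinearMap.ext <| Bal.lin_ext fun x y => by simp [smul_tmul]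

variable (X Y) in
/-- `(x ⊗ y) a = x ⊗ y a`. -/
def Bal.ract : Aᵐᵒᵖ →ₐ[ℂ] Module.End ℂ (Bal X Y) where
  toFun a := Bal.map LinearMap.id (Y.ract a) (fun _ _ => rfl) (fun b y => (Y.lact_ract b a y).symm)
  map_one' := LinearMap.ext <| Bal.lin_ext fun x y => by simp
  map_mul' a b := LinearMap.ext <| Bal.lin_ext fun x y => by simp
  map_zero' := LinearMap.ext <| Bal.lin_ext fun x y => by
    simpa using tmul_smul 0 x (0 : Y)
  map_add' a b := LinearMap.ext <| Bal.lin_ext fun x y => by simp [tmul_add]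
  commutes' z := LinearMap.ext <| Bal.lin_ext fun x y => by
    rw [Bal.map_tmul, AlgHom.commutes]
    simp [tmul_smul]

@[simp] theorem Bal.lact_tmul (a : A) (x : X) (y : Y) :
    Bal.lact X Y a (tmul x y) = tmul (X.lact a x) y := rfl
@[simp] theorem Bal.ract_tmul (a : Aᵐᵒᵖ) (x : X) (y : Y) :
    Bal.ract X Y a (tmul x y) = tmul x (Y.ract a y) := rfl

/-- The map `x ⊗ y ↦ ⟨b, x⟩ y`. -/
def Bal.contract (b : X) : Bal X Y →ₗ[ℂ] Y :=
  Bal.lift (Y.lact.toLinearMap ∘ₗ X.inner b) fun x a y => by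
    simp [X.inner_ract]

@[simp] theorem Bal.contract_tmul (b x : X) (y : Y) :
    Bal.contract b (tmul x y) = Y.lact (X.inner b x) y := rfl

variable (X Y) in
/-- The inner product, written with a projective basis of `X`; it does not depend on the basis, by
`Bal.inner_tmul`. -/
def Bal.inner : Bal X Y →ₗ⋆[ℂ] Bal X Y →ₗ[ℂ] A :=
  ∑ i, (Y.inner.comp (Bal.contract (X.exists_basis.choose_spec.choose i))).compl₂
    (Bal.contract (X.exists_basis.choose_spec.choose i))

theorem Bal.inner_apply (s t : Bal X Y) : Bal.inner X Y s t =
    ∑ i, Y.inner (Bal.contract (X.exists_basis.choose_spec.choose i) s)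
      (Bal.contract (X.exists_basis.choose_spec.choose i) t) := by
  simp [Bal.inner]

theorem Bal.inner_tmul (x x' : X) (y y' : Y) :
    Bal.inner X Y (tmul x y) (tmul x' y') = Y.inner y (Y.lact (X.inner x x') y') := by
  rw [Bal.inner_apply]
  conv_rhs => rw [X.exists_basis.choose_spec.choose_spec x']
  simp only [map_sum, LinearMap.sum_apply, X.inner_ract, Bal.contract_tmul, Y.inner_lact,
    X.star_inner, map_mul, Module.End.mul_apply]

theorem Bal.basis {n m : ℕ} {b : Fin n → X} {c : Fin m → Y} (hb : IsProjBasis X.ract X.inner b)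
    (hc : IsProjBasis Y.ract Y.inner c) :
    IsProjBasis (Bal.ract X Y) (Bal.inner X Y)
      (fun k => tmul (b (finProdFinEquiv.symm k).1) (c (finProdFinEquiv.symm k).2)) := by
  intro t
  induction t using Bal.induction with
  | h1 x y =>
    simp only [Bal.inner_tmul, Bal.ract_tmul]
    rw [finProdFinEquiv.symm.sum_comp
      (fun p : Fin n × Fin m =>
        tmul (b p.1) (Y.ract (op (Y.inner (c p.2) (Y.lact (X.inner (b p.1) x) y))) (c p.2))),
      Fintype.sum_prod_type]
    simp only [← tmul_sum, ← hc _]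
    simp only [← FGCorr.ract_tmul, ← sum_tmul, ← hb _]
  | h2 t t' ht ht' =>
    simp only [map_add, MulOpposite.op_add, LinearMap.add_apply, Finset.sum_add_distrib]
    rw [← ht, ← ht']

theorem Bal.star_inner (s t : Bal X Y) : star (Bal.inner X Y s t) = Bal.inner X Y t s := by
  simp only [Bal.inner_apply, star_sum, Y.star_inner]

theorem Bal.inner_ract (s t : Bal X Y) (a : A) :
    Bal.inner X Y s (Bal.ract X Y (op a) t) = Bal.inner X Y s t * a := by
  induction t using Bal.induction with
  | h1 x y =>
    induction s using Bal.induction with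
    | h1 x' y' => simp only [Bal.ract_tmul, Bal.inner_tmul, Y.lact_ract, Y.inner_ract]
    | h2 s s' h h' => simp only [map_add, LinearMap.add_apply, add_mul, h, h']
  | h2 t t' h h' => simp only [map_add, add_mul, h, h']

variable (X Y) in
/-- The tensor product `X ⊠_A Y` of correspondences. -/
def tensor : FGCorr A where
  carrier := Bal X Y
  lact := Bal.lact X Y
  ract := Bal.ract X Y
  lact_ract a b t := by
    induction t using Bal.induction with
    | h1 x y => rfl
    | h2 t t' h h' => simp only [map_add, h, h']
  inner := Bal.inner X Y
  inner_ract := Bal.inner_ract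
  star_inner := Bal.star_inner
  inner_self_nonneg t := by
    rw [Bal.inner_apply]
    exact Finset.sum_nonneg fun i _ => Y.inner_self_nonneg _
  inner_self_eq_zero t ht := by
    rw [Bal.inner_apply, Finset.sum_eq_zero_iff_of_nonneg fun i _ => Y.inner_self_nonneg _] at ht
    have key : ∀ s : Bal X Y, s = ∑ i, tmul (X.exists_basis.choose_spec.choose i)
        (Bal.contract (X.exists_basis.choose_spec.choose i) s) := by
      intro s
      induction s using Bal.induction with
      | h1 x y =>
        simp only [Bal.contract_tmul, ← FGCorr.ract_tmul, ← sum_tmul]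
        rw [← X.exists_basis.choose_spec.choose_spec x]
      | h2 s s' h h' =>
        simp only [map_add, tmul_add, Finset.sum_add_distrib]
        rw [← h, ← h']
    rw [key t]
    refine Finset.sum_eq_zero fun i hi => ?_
    rw [Y.inner_self_eq_zero _ (ht i hi)]
    exact map_zero (tmulₗ X Y _)
  inner_lact a s t := by
    induction t using Bal.induction with
    | h1 x y =>
      induction s using Bal.induction with
      | h1 x' y' => simp only [Bal.lact_tmul, Bal.inner_tmul, X.inner_lact]
      | h2 s s' h h' => simp only [map_add, LinearMap.add_apply, h, h']
    | h2 t t' h h' => simp only [map_add, h, h']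
  complete := complete_of_basis _ _ Bal.inner_ract Bal.star_inner
    (Bal.basis X.exists_basis.choose_spec.choose_spec Y.exists_basis.choose_spec.choose_spec)
  exists_basis := ⟨_, _,
    Bal.basis X.exists_basis.choose_spec.choose_spec Y.exists_basis.choose_spec.choose_spec⟩

end Tensor

section Free

/-- The inner product `⟨x, y⟩ = ∑ i, (x i)* (y i)` on `A^{⊕k}`. -/
def freeInner (k : ℕ) : (Fin k → A) →ₗ⋆[ℂ] (Fin k → A) →ₗ[ℂ] A :=
  LinearMap.mk₂'ₛₗ (starRingEnd ℂ) (RingHom.id ℂ) (fun x y => ∑ i, star (x i) * y i)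
    (fun x x' y => by simp [add_mul, Finset.sum_add_distrib])
    (fun z x y => by simp [Finset.smul_sum])
    (fun x y y' => by simp [mul_add, Finset.sum_add_distrib])
    (fun z x y => by simp [Finset.smul_sum])

theorem freeInner_apply {k : ℕ} (x y : Fin k → A) : freeInner k x y = ∑ i, star (x i) * y i := rfl

theorem freeInner_ract {k : ℕ} (x y : Fin k → A) (a : A) :
    freeInner k x (Algebra.lsmul ℂ ℂ (Fin k → A) (op a) y) = freeInner k x y * a := by
  simp [freeInner_apply, Finset.sum_mul, mul_assoc]

theorem star_freeInner {k : ℕ} (x y : Fin k → A) :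
    star (freeInner k x y) = freeInner k y x := by
  simp [freeInner_apply]

theorem free_basis (k : ℕ) : IsProjBasis (A := A) (Algebra.lsmul ℂ ℂ (Fin k → A)) (freeInner k)
    (fun i : Fin k => Pi.single i (1 : A)) := fun x => by
  ext j
  simp [freeInner_apply, Pi.single_apply, apply_ite star]

variable (A) in
/-- The direct sum `A^{⊕k}` of `k` copies of the trivial correspondence. -/
def free (k : ℕ) : FGCorr A where
  carrier := Fin k → A
  lact := Algebra.lsmul ℂ ℂ (Fin k → A)
  ract := Algebra.lsmul ℂ ℂ (Fin k → A)
  lact_ract a b x := smul_comm a b x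
  inner := freeInner k
  inner_ract := freeInner_ract
  star_inner := star_freeInner
  inner_self_nonneg x := by
    rw [freeInner_apply]
    exact Finset.sum_nonneg fun i _ => star_mul_self_nonneg (x i)
  inner_self_eq_zero x hx := by
    rw [freeInner_apply, Finset.sum_eq_zero_iff_of_nonneg
      fun i _ => star_mul_self_nonneg (x i)] at hx
    funext i
    exact CStarRing.star_mul_self_eq_zero_iff _ |>.1 (hx i (Finset.mem_univ i))
  inner_lact a x y := by simp [freeInner_apply, mul_assoc]
  complete := complete_of_basis _ _ freeInner_ract star_freeInner (free_basis k)
  exists_basis := ⟨k, _, free_basis k⟩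

/-- The inner product `⟨x, y⟩ = x* y` on `A`. -/
def unitInner : A →ₗ⋆[ℂ] A →ₗ[ℂ] A :=
  LinearMap.mk₂'ₛₗ (starRingEnd ℂ) (RingHom.id ℂ) (fun x y => star x * y)
    (fun x x' y => by simp [add_mul]) (fun z x y => by simp)
    (fun x y y' => by simp [mul_add]) (fun z x y => by simp)

theorem unitInner_apply (x y : A) : unitInner x y = star x * y := rfl

theorem unitInner_ract (x y a : A) :
    unitInner x (Algebra.lsmul ℂ ℂ A (op a) y) = unitInner x y * a := by
  simp [unitInner_apply, mul_assoc]

theorem star_unitInner (x y : A) : star (unitInner x y) = unitInner y x := by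
  simp [unitInner_apply]

theorem unit_basis : IsProjBasis (A := A) (Algebra.lsmul ℂ ℂ A) unitInner
    (fun _ : Fin 1 => (1 : A)) := fun x => by
  simp [unitInner_apply]

variable (A) in
/-- The trivial correspondence `A`. -/
def unit : FGCorr A where
  carrier := A
  lact := Algebra.lsmul ℂ ℂ A
  ract := Algebra.lsmul ℂ ℂ A
  lact_ract a b x := smul_comm a b x
  inner := unitInner
  inner_ract := unitInner_ract
  star_inner := star_unitInner
  inner_self_nonneg x := star_mul_self_nonneg x
  inner_self_eq_zero x hx := CStarRing.star_mul_self_eq_zero_iff _ |>.1 hx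
  inner_lact a x y := by simp [unitInner_apply, mul_assoc]
  complete := complete_of_basis _ _ unitInner_ract star_unitInner unit_basis
  exists_basis := ⟨1, _, unit_basis⟩

end Free

section Monoidal

variable {X Y Z W V : FGCorr A}

/-- The simple tensor `x ⊗ y` in `X ⊠ Y`. -/
def tens (x : X) (y : Y) : tensor X Y := tmul x y

theorem ract_tens (x : X) (a : A) (y : Y) :
    tens (X.ract (op a) x) y = tens x (Y.lact a y) := ract_tmul x a y
theorem add_tens (x x' : X) (y : Y) : tens (x + x') y = tens x y + tens x' y := add_tmul x x' y
theorem tens_add (x : X) (y y' : Y) : tens x (y + y') = tens x y + tens x y' := tmul_add x y y'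
theorem smul_tens (z : ℂ) (x : X) (y : Y) : tens (z • x) y = z • tens x y := smul_tmul z x y
theorem tens_smul (z : ℂ) (x : X) (y : Y) : tens x (z • y) = z • tens x y := tmul_smul z x y
theorem lact_tens (a : A) (x : X) (y : Y) :
    (tensor X Y).lact a (tens x y) = tens (X.lact a x) y := rfl
theorem ract_tens' (a : Aᵐᵒᵖ) (x : X) (y : Y) :
    (tensor X Y).ract a (tens x y) = tens x (Y.ract a y) := rfl
theorem inner_tens (x x' : X) (y y' : Y) :
    (tensor X Y).inner (tens x y) (tens x' y') = Y.inner y (Y.lact (X.inner x x') y') :=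
  Bal.inner_tmul x x' y y'

theorem tens_induction {p : tensor X Y → Prop} (h1 : ∀ x y, p (tens x y))
    (h2 : ∀ t t', p t → p t' → p (t + t')) (t : tensor X Y) : p t :=
  Bal.induction (p := p) t h1 h2

/-- The linear map on `X ⊠ Y` induced by a balanced bilinear map. -/
def tensLift {U : Type} [AddCommGroup U] [Module ℂ U] (f : X → Y → U)
    (h1 : ∀ x x' y, f (x + x') y = f x y + f x' y) (h2 : ∀ (z : ℂ) x y, f (z • x) y = z • f x y)
    (h3 : ∀ x y y', f x (y + y') = f x y + f x y') (h4 : ∀ (z : ℂ) x y, f x (z • y) = z • f x y)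
    (hf : ∀ x a y, f (X.ract (op a) x) y = f x (Y.lact a y)) : tensor X Y →ₗ[ℂ] U :=
  Bal.lift (LinearMap.mk₂ ℂ f h1 h2 h3 h4) hf

@[simp] theorem tensLift_tens {U : Type} [AddCommGroup U] [Module ℂ U] (f : X → Y → U)
    (h1 h2 h3 h4 hf) (x : X) (y : Y) :
    tensLift (U := U) f h1 h2 h3 h4 hf (tens x y) = f x y := rfl

theorem tensor_hom_ext {f g : tensor X Y ⟶ Z}
    (h : ∀ (x : X) (y : Y), Hom.lin f (tens x y) = Hom.lin g (tens x y)) : f = g :=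
  hom_ext (Bal.lin_ext h)

theorem tensor_hom_ext₃ {f g : tensor (tensor X Y) Z ⟶ W}
    (h : ∀ (x : X) (y : Y) (z : Z),
      Hom.lin f (tens (tens x y) z) = Hom.lin g (tens (tens x y) z)) : f = g :=
  tensor_hom_ext fun t z => by
    induction t using tens_induction with
    | h1 x y => exact h x y z
    | h2 t t' h h' => simp only [map_add, add_tens, h, h']

theorem tensor_hom_ext₄ {f g : tensor (tensor (tensor X Y) Z) V ⟶ W}
    (h : ∀ (x : X) (y : Y) (z : Z) (v : V), Hom.lin f (tens (tens (tens x y) z) v) =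
      Hom.lin g (tens (tens (tens x y) z) v)) : f = g :=
  tensor_hom_ext₃ fun t z v => by
    induction t using tens_induction with
    | h1 x y => exact h x y z v
    | h2 t t' h h' => simp only [map_add, add_tens, h, h']

/-- A morphism out of a tensor product, from a linear map that respects the actions on simple
tensors. -/
def tensorHomMk (f : tensor X Y →ₗ[ℂ] Z)
    (hl : ∀ a x y, f (tens (X.lact a x) y) = Z.lact a (f (tens x y)))
    (hr : ∀ a x y, f (tens x (Y.ract a y)) = Z.ract a (f (tens x y))) : tensor X Y ⟶ Z :=
  mkHom f
    (fun a t => by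
      induction t using tens_induction with
      | h1 x y => exact hl a x y
      | h2 t t' h h' => simp only [map_add, h, h'])
    (fun a t => by
      induction t using tens_induction with
      | h1 x y => exact hr a x y
      | h2 t t' h h' => simp only [map_add, h, h'])

/-- The tensor product of morphisms. -/
def tensorMap {X' Y' : FGCorr A} (f : X ⟶ X') (g : Y ⟶ Y') : tensor X Y ⟶ tensor X' Y' :=
  tensorHomMk
    (tensLift (fun x y => tens (Hom.lin f x) (Hom.lin g y))
      (by simp [add_tens]) (by simp [smul_tens]) (by simp [tens_add]) (by simp [tens_smul])
      (by simp [lin_ract, lin_lact, ract_tens]))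
    (by simp [lact_tens, lin_lact]) (by simp [ract_tens', lin_ract])

@[simp] theorem tensorMap_tens {X' Y' : FGCorr A} (f : X ⟶ X') (g : Y ⟶ Y') (x : X) (y : Y) :
    Hom.lin (tensorMap f g) (tens x y) = tens (Hom.lin f x) (Hom.lin g y) := rfl

/-- `x ⊗ y ↦ x ⊗ (y ⊗ z)`. -/
def assocHomAux (X Y : FGCorr A) {Z : FGCorr A} (z : Z) :
    tensor X Y →ₗ[ℂ] tensor X (tensor Y Z) :=
  tensLift (fun x y => tens x (tens y z))
    (by simp [add_tens]) (by simp [smul_tens]) (by simp [add_tens, tens_add])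
    (by simp [smul_tens, tens_smul]) (by simp [ract_tens, lact_tens])

/-- `y ⊗ z ↦ (x ⊗ y) ⊗ z`. -/
def assocInvAux {X : FGCorr A} (x : X) (Y Z : FGCorr A) :
    tensor Y Z →ₗ[ℂ] tensor (tensor X Y) Z :=
  tensLift (fun y z => tens (tens x y) z)
    (by simp [add_tens, tens_add]) (by simp [smul_tens, tens_smul]) (by simp [tens_add])
    (by simp [tens_smul]) (by simp [← ract_tens, ract_tens'])

/-- The associator `(x ⊗ y) ⊗ z ↦ x ⊗ (y ⊗ z)`. -/
def assoc (X Y Z : FGCorr A) : tensor (tensor X Y) Z ≅ tensor X (tensor Y Z) where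
  hom := tensorHomMk
    (tensLift (fun t z => assocHomAux X Y z t) (by simp) (by simp)
      (fun t z z' => by
        induction t using tens_induction with
        | h1 x y => simp [assocHomAux, tens_add]
        | h2 t t' h h' => simp only [map_add, h, h']; abel)
      (fun c t z => by
        induction t using tens_induction with
        | h1 x y => simp [assocHomAux, tens_smul]
        | h2 t t' h h' => simp only [map_add, h, h', smul_add])
      (fun t a z => by
        induction t using tens_induction with
        | h1 x y => simp [assocHomAux, ract_tens', ract_tens]
        | h2 t t' h h' => simp only [map_add, h, h']))
    (fun a t z => by
      induction t using tens_induction with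
      | h1 x y => rfl
      | h2 t t' h h' => simp only [map_add, add_tens, h, h'])
    (fun a t z => by
      induction t using tens_induction with
      | h1 x y => rfl
      | h2 t t' h h' => simp only [map_add, add_tens, h, h'])
  inv := tensorHomMk
    (tensLift (fun x t => assocInvAux x Y Z t)
      (fun x x' t => by
        induction t using tens_induction with
        | h1 x y => simp [assocInvAux, add_tens]
        | h2 t t' h h' => simp only [map_add, h, h']; abel)
      (fun c x t => by
        induction t using tens_induction with
        | h1 x y => simp [assocInvAux, smul_tens]
        | h2 t t' h h' => simp only [map_add, h, h', smul_add])
      (by simp) (by simp)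
      (fun x a t => by
        induction t using tens_induction with
        | h1 x y => simp [assocInvAux, lact_tens, ract_tens]
        | h2 t t' h h' => simp only [map_add, h, h']))
    (fun a x t => by
      induction t using tens_induction with
      | h1 y z => rfl
      | h2 t t' h h' => simp only [map_add, tens_add, h, h'])
    (fun a x t => by
      induction t using tens_induction with
      | h1 y z => rfl
      | h2 t t' h h' => simp only [map_add, tens_add, h, h'])
  hom_inv_id := tensor_hom_ext₃ fun x y z => rfl
  inv_hom_id := tensor_hom_ext fun x t => by
    induction t using tens_induction with
    | h1 y z => rfl
    | h2 t t' h h' => simp only [map_add, tens_add, h, h']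

@[simp] theorem assoc_hom_tens (x : X) (y : Y) (z : Z) :
    Hom.lin (assoc X Y Z).hom (tens (tens x y) z) = tens x (tens y z) := rfl

theorem lact_add_apply (X : FGCorr A) (a b : A) (x : X) :
    X.lact (a + b) x = X.lact a x + X.lact b x := by simp
theorem lact_smul_apply (X : FGCorr A) (z : ℂ) (a : A) (x : X) :
    X.lact (z • a) x = z • X.lact a x := by simp
theorem lact_mul_apply (X : FGCorr A) (a b : A) (x : X) :
    X.lact (a * b) x = X.lact a (X.lact b x) := by simp
theorem ract_add_apply (X : FGCorr A) (x : X) (a b : A) :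
    X.ract (op (a + b)) x = X.ract (op a) x + X.ract (op b) x := by simp
theorem ract_smul_apply (X : FGCorr A) (z : ℂ) (x : X) (a : A) :
    X.ract (op (z • a)) x = z • X.ract (op a) x := by simp
theorem ract_mul_apply (X : FGCorr A) (x : X) (a b : A) :
    X.ract (op (a * b)) x = X.ract (op b) (X.ract (op a) x) := by simp

/-- An element of `A`, regarded as an element of the trivial bimodule. -/
def toUnit (a : A) : unit A := a

/-- The isomorphism `a ⊗ x ↦ a x`. -/
def leftUnit (X : FGCorr A) : tensor (unit A) X ≅ X where
  hom := tensorHomMk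
    (tensLift (X := unit A) (fun a x => X.lact a x) (X.lact_add_apply) (X.lact_smul_apply)
      (by simp) (by simp) (X.lact_mul_apply))
    (X.lact_mul_apply)
    (fun a b x => X.lact_ract b a x)
  inv := mkHom
    { toFun := fun x => tens (toUnit 1) x
      map_add' := by simp [tens_add]
      map_smul' := by simp [tens_smul] }
    (fun a x => by
      refine (ract_tens (X := unit A) (toUnit (1 : A)) a x).symm.trans ?_
      change tens (toUnit (1 * a)) x = tens (toUnit (a * 1)) x
      rw [one_mul, mul_one])
    (fun a x => rfl)
  hom_inv_id := tensor_hom_ext fun a x => by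
    refine (ract_tens (X := unit A) (toUnit (1 : A)) a x).symm.trans ?_
    exact congrArg (fun b : A => tens (toUnit b) x) (one_mul (M := A) a)
  inv_hom_id := hom_ext fun x => congrArg (fun T => T x) (map_one X.lact)

/-- The isomorphism `x ⊗ a ↦ x a`. -/
def rightUnit (X : FGCorr A) : tensor X (unit A) ≅ X where
  hom := tensorHomMk
    (tensLift (Y := unit A) (fun x a => X.ract (op a) x) (by simp) (by simp)
      (X.ract_add_apply) (X.ract_smul_apply) (fun x a b => (X.ract_mul_apply x a b).symm))
    (fun a x b => (X.lact_ract a (op b) x).symm)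
    (fun a x b => X.ract_mul_apply x b a.unop)
  inv := mkHom
    { toFun := fun x => tens x (toUnit 1)
      map_add' := by simp [add_tens]
      map_smul' := by simp [smul_tens] }
    (fun a x => rfl)
    (fun a x => by
      refine (ract_tens x a.unop (toUnit 1)).trans ?_
      change tens x (toUnit (a.unop * 1)) = tens x (toUnit (1 * a.unop))
      rw [one_mul, mul_one])
  hom_inv_id := tensor_hom_ext fun x a => by
    refine (ract_tens (Y := unit A) x a (toUnit (1 : A))).trans ?_
    exact congrArg (fun b : A => tens x (toUnit b)) (mul_one (M := A) a)
  inv_hom_id := hom_ext fun x => congrArg (fun T => T x) (map_one X.ract)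

@[simp] theorem leftUnit_hom_tens (a : A) (x : X) :
    Hom.lin (leftUnit X).hom (tens (toUnit a) x) = X.lact a x := rfl
@[simp] theorem rightUnit_hom_tens (a : A) (x : X) :
    Hom.lin (rightUnit X).hom (tens x (toUnit a)) = X.ract (op a) x := rfl

/-- The tensor category of correspondences with finite projective bases. -/
instance : MonoidalCategory (FGCorr A) where
  tensorObj := tensor
  whiskerLeft X _ _ f := tensorMap (𝟙 X) f
  whiskerRight f Y := tensorMap f (𝟙 Y)
  tensorHom := tensorMap
  tensorUnit := unit A
  associator := assoc
  leftUnitor := leftUnit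
  rightUnitor := rightUnit
  tensorHom_def _ _ := tensor_hom_ext fun _ _ => rfl
  id_tensorHom_id _ _ := tensor_hom_ext fun _ _ => rfl
  tensorHom_comp_tensorHom _ _ _ _ := tensor_hom_ext fun _ _ => rfl
  whiskerLeft_id _ _ := tensor_hom_ext fun _ _ => rfl
  id_whiskerRight _ _ := tensor_hom_ext fun _ _ => rfl
  associator_naturality _ _ _ := tensor_hom_ext₃ fun _ _ _ => rfl
  leftUnitor_naturality f := tensor_hom_ext fun a x => (lin_lact f a x).symm
  rightUnitor_naturality f := tensor_hom_ext fun x a => (lin_ract f (op a) x).symm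
  pentagon _ _ _ _ := tensor_hom_ext₄ fun _ _ _ _ => rfl
  triangle _ _ := tensor_hom_ext₃ fun x a y => (ract_tens x a y).symm

end Monoidal

end FGCorr
end Corr

section Dagger

/-- Dagger categories. -/
class DaggerCategory (C : Type*) [Category C] where
  dagger : ∀ {X Y : C}, (X ⟶ Y) → (Y ⟶ X)
  dagger_id : ∀ X : C, dagger (𝟙 X) = 𝟙 X
  dagger_comp : ∀ {X Y Z : C} (f : X ⟶ Y) (g : Y ⟶ Z), dagger (f ≫ g) = dagger g ≫ dagger f
  dagger_dagger : ∀ {X Y : C} (f : X ⟶ Y), dagger (dagger f) = f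

instance {A : Type} [CStarAlgebra A] [PartialOrder A] [StarOrderedRing A] :
    DaggerCategory (FGCorr A) where
  dagger := FGCorr.dag
  dagger_id X := FGCorr.hom_ext fun y => FGCorr.ext_inner fun x => by
    rw [← FGCorr.inner_dag]; rfl
  dagger_comp f g := FGCorr.hom_ext fun y => FGCorr.ext_inner fun x => by
    rw [← FGCorr.inner_dag]
    simp only [FGCorr.lin_comp]
    rw [← FGCorr.inner_dag, ← FGCorr.inner_dag]
  dagger_dagger {X Y} f := FGCorr.hom_ext fun y => FGCorr.ext_inner fun x => by
    rw [← FGCorr.inner_dag, ← Y.star_inner, ← X.star_inner, FGCorr.inner_dag]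

instance {C : Type*} [Category C] [DaggerCategory C] (P : ObjectProperty C) :
    DaggerCategory P.FullSubcategory where
  dagger f := ObjectProperty.homMk (DaggerCategory.dagger f.hom)
  dagger_id X := by ext; exact DaggerCategory.dagger_id X.obj
  dagger_comp f g := by ext; exact DaggerCategory.dagger_comp f.hom g.hom
  dagger_dagger f := by ext; exact DaggerCategory.dagger_dagger f.hom

open Functor.LaxMonoidal Functor.OplaxMonoidal in
/-- Unitary tensor functors: monoidal functors that preserve the dagger and whose structure
isomorphisms `F X ⊗ F Y ≅ F (X ⊗ Y)` and `𝟙 ≅ F 𝟙` are unitary (`δ` and `η` are the inverses of `μ`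
and `ε`). -/
structure IsUnitaryTensorFunctor {C D : Type*} [Category C] [Category D] [MonoidalCategory C]
    [MonoidalCategory D] [DaggerCategory C] [DaggerCategory D] (F : C ⥤ D) [F.Monoidal] :
    Prop where
  map_dagger : ∀ {X Y : C} (f : X ⟶ Y),
    F.map (DaggerCategory.dagger f) = DaggerCategory.dagger (F.map f)
  dagger_μ : ∀ X Y : C, DaggerCategory.dagger (μ F X Y) = δ F X Y
  dagger_ε : DaggerCategory.dagger (ε F) = η F

end Dagger

section Hilb

/-- Finite-dimensional complex Hilbert spaces. -/
structure HilbFd where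
  carrier : Type
  [normedAddCommGroup : NormedAddCommGroup carrier]
  [innerProductSpace : InnerProductSpace ℂ carrier]
  [finiteDimensional : FiniteDimensional ℂ carrier]

attribute [instance] HilbFd.normedAddCommGroup HilbFd.innerProductSpace HilbFd.finiteDimensional

namespace HilbFd

instance : CoeSort HilbFd Type := ⟨HilbFd.carrier⟩

instance : Category HilbFd where
  Hom E F := E →ₗ[ℂ] F
  id E := LinearMap.id
  comp f g := g ∘ₗ f

instance (E F : HilbFd) : AddCommGroup (E ⟶ F) := inferInstanceAs (AddCommGroup (E →ₗ[ℂ] F))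
instance (E F : HilbFd) : Module ℂ (E ⟶ F) := inferInstanceAs (Module ℂ (E →ₗ[ℂ] F))

instance : Preadditive HilbFd where
  add_comp _ _ _ f f' g := LinearMap.comp_add f f' g
  comp_add _ _ _ f g g' := LinearMap.add_comp f g' g

instance : Linear ℂ HilbFd where
  smul_comp _ _ _ z f g := LinearMap.comp_smul g z f
  comp_smul _ _ _ f z g := LinearMap.smul_comp z g f

/-- The linear map underlying a morphism. -/
def lin {E F : HilbFd} (f : E ⟶ F) : E →ₗ[ℂ] F := f

/-- An isomorphism from a linear equivalence. -/
def isoMk {E F : HilbFd} (e : E ≃ₗ[ℂ] F) : E ≅ F where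
  hom := e.toLinearMap
  inv := e.symm.toLinearMap
  hom_inv_id := LinearMap.ext e.symm_apply_apply
  inv_hom_id := LinearMap.ext e.apply_symm_apply

instance : MonoidalCategory HilbFd where
  tensorObj E F := ⟨E ⊗[ℂ] F⟩
  whiskerLeft _ _ _ f := TensorProduct.map LinearMap.id (lin f)
  whiskerRight f _ := TensorProduct.map (lin f) LinearMap.id
  tensorHom f g := TensorProduct.map (lin f) (lin g)
  tensorUnit := ⟨ℂ⟩
  associator E F G := isoMk (TensorProduct.assoc ℂ E F G)
  leftUnitor E := isoMk (TensorProduct.lid ℂ E)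
  rightUnitor E := isoMk (TensorProduct.rid ℂ E)
  tensorHom_def _ _ := TensorProduct.ext' fun _ _ => rfl
  id_tensorHom_id _ _ := TensorProduct.ext' fun _ _ => rfl
  tensorHom_comp_tensorHom _ _ _ _ := TensorProduct.ext' fun _ _ => rfl
  whiskerLeft_id _ _ := TensorProduct.ext' fun _ _ => rfl
  id_whiskerRight _ _ := TensorProduct.ext' fun _ _ => rfl
  associator_naturality _ _ _ := TensorProduct.ext_threefold fun _ _ _ => rfl
  leftUnitor_naturality f := TensorProduct.ext' fun z x => ((lin f).map_smul z x).symm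
  rightUnitor_naturality f := TensorProduct.ext' fun x z => ((lin f).map_smul z x).symm
  pentagon _ _ _ _ := TensorProduct.ext_fourfold fun _ _ _ _ => rfl
  triangle _ _ := TensorProduct.ext_threefold fun x z y => (TensorProduct.smul_tmul z x y).symm

instance : BraidedCategory HilbFd where
  braiding E F := isoMk (TensorProduct.comm ℂ E F)
  braiding_naturality_right _ _ _ _ := TensorProduct.ext' fun _ _ => rfl
  braiding_naturality_left _ _ := TensorProduct.ext' fun _ _ => rfl
  hexagon_forward _ _ _ := TensorProduct.ext_threefold fun _ _ _ => rfl
  hexagon_reverse E F G := by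
    rw [← cancel_epi (MonoidalCategoryStruct.associator E F G).hom]
    exact TensorProduct.ext_threefold fun _ _ _ => rfl

instance : DaggerCategory HilbFd where
  dagger f := LinearMap.adjoint (lin f)
  dagger_id _ := LinearMap.adjoint_id
  dagger_comp f g := LinearMap.adjoint_comp (lin g) (lin f)
  dagger_dagger f := LinearMap.adjoint_adjoint (lin f)

end HilbFd
end Hilb

section DHR

variable {A : Type} [CStarAlgebra A] [PartialOrder A] [StarOrderedRing A]
  (loc : Finset ℤ → StarSubalgebra ℂ A)

/-- `A_{Iᶜ}`: the C*-algebra generated by the local algebras of the bounded intervals disjoint from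
`I`. -/
def complAlg (I : Finset ℤ) : StarSubalgebra ℂ A :=
  (⨆ (p : ℤ) (q : ℤ) (_ : Disjoint (Finset.Icc p q) I), loc (Finset.Icc p q)).topologicalClosure

/-- `[A_{Iᶜ}, x] = 0`. -/
def IsLocalized (I : Finset ℤ) {X : FGCorr A} (x : X) : Prop :=
  ∀ a ∈ complAlg loc I, X.lact a x = X.ract (op a) x

/-- DHR bimodules: for every sufficiently large interval `I` there is a finite projective basis
whose elements commute with `A_{Iᶜ}`. -/
def IsDHR : ObjectProperty (FGCorr A) := fun X =>
  ∃ R : ℕ, ∀ p q : ℤ, R ≤ (Finset.Icc p q).card →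
    ∃ (n : ℕ) (b : Fin n → X), IsProjBasis X.ract X.inner b ∧
      ∀ i, IsLocalized loc (Finset.Icc p q) (b i)

instance : (IsDHR loc).IsMonoidal where
  prop_unit := ⟨0, fun p q _ => ⟨1, _, FGCorr.unit_basis, fun i a _ => by
    change a * 1 = 1 * a
    rw [mul_one, one_mul]⟩⟩
  prop_tensor X Y := by
    rintro ⟨R, hR⟩ ⟨S, hS⟩
    refine ⟨max R S, fun p q h => ?_⟩
    obtain ⟨n, b, hb, hbl⟩ := hR p q (le_of_max_le_left h)
    obtain ⟨m, c, hc, hcl⟩ := hS p q (le_of_max_le_right h)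
    refine ⟨n * m, _, FGCorr.Bal.basis hb hc, fun k a ha => ?_⟩
    change FGCorr.tens (X.lact a (b _)) (c _) = FGCorr.tens (b _) (Y.ract (op a) (c _))
    rw [hbl _ a ha, FGCorr.ract_tens, hcl _ a ha]

/-- The tensor category of DHR bimodules. -/
abbrev DHR : Type 1 := (IsDHR loc).FullSubcategory

/-- Dualizable objects: there are a right dual and a left dual among the DHR bimodules. -/
def IsDualizable : ObjectProperty (DHR loc) := fun X =>
  (∃ Y, Nonempty (ExactPairing X Y)) ∧ ∃ Y, Nonempty (ExactPairing Y X)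

open MonoidalCategory in
instance : (IsDualizable loc).IsMonoidal where
  prop_unit := ⟨⟨𝟙_ _, ⟨inferInstance⟩⟩, ⟨𝟙_ _, ⟨inferInstance⟩⟩⟩
  prop_tensor X X' := by
    rintro ⟨⟨Y, ⟨h⟩⟩, ⟨Z, ⟨k⟩⟩⟩ ⟨⟨Y', ⟨h'⟩⟩, ⟨Z', ⟨k'⟩⟩⟩
    exact ⟨⟨Y' ⊗ Y, ⟨inferInstance⟩⟩, ⟨Z' ⊗ Z, ⟨inferInstance⟩⟩⟩

/-- The tensor category of dualizable DHR bimodules. -/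
abbrev DHR₀ : Type 1 := (IsDualizable loc).FullSubcategory

/-- The underlying correspondence. -/
def DHR₀.corr {loc : Finset ℤ → StarSubalgebra ℂ A} (X : DHR₀ loc) : FGCorr A := X.obj.obj

open MonoidalCategory in
/-- The DHR braiding: the braiding that maps `x ⊗ y` to `y ⊗ x` whenever `x` is localized in an
interval `I` and `y` is localized in an interval `J` sufficiently far to the right of `I`. As DHR
bimodules have projective bases localized in any sufficiently large interval, there is at most one
such braiding. -/
def IsDHRBraiding [BraidedCategory (DHR₀ loc)] : Prop :=
  ∀ X Y : DHR₀ loc, ∃ R : ℕ, ∀ p q r s : ℤ,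
    (∀ i ∈ Finset.Icc p q, ∀ j ∈ Finset.Icc r s, i + R < j) →
    ∀ (x : X.corr) (y : Y.corr),
      IsLocalized loc (Finset.Icc p q) x → IsLocalized loc (Finset.Icc r s) y →
      FGCorr.Hom.lin (β_ X Y).hom.hom.hom (FGCorr.tens x y) = FGCorr.tens y x

end DHR

end RotorChain
end

/-!
The vectors of a bimodule that commute with every element of `LInf` have scalar inner products,
because the center of `LInf` is `ℂ`. So they form a Hilbert space. If finitely many orthonormal
vectors of this kind are a projective basis, then the bimodule is free. Once every dualizable DHR
bimodule is known to be of this form, taking the commuting vectors is the required equivalence.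

To find these vectors, let `b₁, …, bₙ` be a projective basis localized in an interval, and let `H`
be the Hilbert space of that interval. By Haag duality the coefficients `⟨bᵢ, a bⱼ⟩` for `a ∈ B(H)`
again lie in `B(H)`, so they define a (nonunital) representation `π` of `B(H)` on `H ⊗ ℂⁿ`. A vector
killed by all matrix units is killed by `π 1`: otherwise an uncountable family of isometries of `H`
with almost disjoint ranges would map it to uncountably many orthogonal nonzero vectors, but
`H ⊗ ℂⁿ` is separable. Hence the range of `π` is spanned by copies of `H`, one for each vector `v`
of an orthonormal basis of the range of `π (|o⟩⟨o|)`. If `Tᵢ` are the components of the intertwiner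
`H → H ⊗ ℂⁿ` that belongs to `v`, then `∑ bᵢ Tᵢ` commutes with `LInf`. The zigzag equations of a
dual bound the number of orthonormal vectors found in this way.

In such bases the coefficients of vectors localized in disjoint intervals lie in commuting local
algebras, so a braiding that flips the commuting vectors also flips localized vectors that are far
apart.
-/

noncomputable section

namespace RotorChain

section Ket
variable {α β γ : Type}

/-- The canonical Hilbert basis of `ℓ²(α)`. -/
def ketBasis (α : Type) : HilbertBasis α ℂ (L2 α) :=
  .ofRepr (LinearIsometryEquiv.refl ℂ _)

/-- The standard basis vector `e_s` of `ℓ²(α)`. -/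
def ket (s : α) : L2 α := ketBasis α s

theorem inner_ket (s : α) (f : L2 α) : ⟪ket s, f⟫_ℂ = f s :=
  ((ketBasis α).repr_apply_apply f s).symm

theorem orthonormal_ket : Orthonormal ℂ (ket : α → L2 α) := (ketBasis α).orthonormal

theorem dense_span_ket : Dense (Submodule.span ℂ (Set.range (ket : α → L2 α)) : Set (L2 α)) :=
  Submodule.dense_iff_topologicalClosure_eq_top.2 (ketBasis α).dense_span

theorem ket_apply (s t : α) [Decidable (t = s)] : (ket s : L2 α) t = if t = s then 1 else 0 := by
  classical
  rw [← inner_ket, orthonormal_iff_ite.1 orthonormal_ket]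
  congr

theorem norm_ket (s : α) : ‖(ket s : L2 α)‖ = 1 := orthonormal_ket.1 s

theorem clm_ext_ket {E : Type*} [NormedAddCommGroup E] [NormedSpace ℂ E] {S T : L2 α →L[ℂ] E}
    (h : ∀ s, S (ket s) = T (ket s)) : S = T :=
  ContinuousLinearMap.ext_on dense_span_ket (Set.forall_mem_range.2 h)

/-- The matrix unit `|e_s⟩⟨e_t|`. -/
def matUnit (s t : α) : L2 α →L[ℂ] L2 α := InnerProductSpace.rankOne ℂ (ket s) (ket t)

theorem matUnit_apply (s t : α) (f : L2 α) : matUnit s t f = f t • ket s := by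
  rw [matUnit, InnerProductSpace.rankOne_apply, inner_ket]

/-- The operator `ξ ↦ slice e b ξ`, that is, `1 ⊗ ⟨e_b|` for `ℓ²(γ) = ℓ²(α) ⊗ ℓ²(β)`. -/
def sliceCLM (e : γ ≃ α × β) (b : β) : L2 γ →L[ℂ] L2 α :=
  LinearMap.mkContinuous
    { toFun := slice e b, map_add' := slice_add e b, map_smul' := slice_smul e b } 1 fun ξ => by
      rw [one_mul]
      refine le_of_sq_le_sq ?_ (norm_nonneg _)
      exact le_hasSum (hasSum_norm_slice e ξ) b fun _ _ => by positivity

theorem sliceCLM_apply (e : γ ≃ α × β) (b : β) (ξ : L2 γ) (a : α) :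
    sliceCLM e b ξ a = ξ (e.symm (a, b)) := rfl

theorem adjoint_sliceCLM_ket (e : γ ≃ α × β) (b : β) (a : α) :
    ContinuousLinearMap.adjoint (sliceCLM e b) (ket a) = ket (e.symm (a, b)) := by
  classical
  ext c
  rw [← inner_ket, ContinuousLinearMap.adjoint_inner_right, ← inner_conj_symm, inner_ket,
    sliceCLM_apply, ket_apply, ket_apply, apply_ite (starRingEnd ℂ), map_one, map_zero]
  exact if_congr eq_comm rfl rfl

theorem ampl_apply (e : γ ≃ α × β) (S : L2 α →L[ℂ] L2 α) (ξ : L2 γ) (c : γ) :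
    ampl e S ξ c = S (slice e (e c).2 ξ) (e c).1 := rfl

theorem slice_ket [DecidableEq β] (e : γ ≃ α × β) (b : β) (d : γ) :
    slice e b (ket d) = if b = (e d).2 then ket (e d).1 else 0 := by
  classical
  ext a
  change (ket d : L2 γ) (e.symm (a, b)) = _
  rw [ket_apply, Equiv.symm_apply_eq, Prod.ext_iff]
  split_ifs <;> simp_all [ket_apply]

theorem ampl_ket [DecidableEq β] (e : γ ≃ α × β) (S : L2 α →L[ℂ] L2 α) (c d : γ) :
    ampl e S (ket d) c = if (e c).2 = (e d).2 then S (ket (e d).1) (e c).1 else 0 := by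
  rw [ampl_apply, slice_ket]
  split_ifs
  · rfl
  · rw [map_zero]; rfl

theorem ampl_injective (e : γ ≃ α × β) [Nonempty β] : Function.Injective (ampl e) := by
  classical
  intro S T hST
  obtain ⟨b⟩ := ‹Nonempty β›
  refine clm_ext_ket fun s => lp.ext (funext fun t => ?_)
  have h := congrArg (fun R : L2 γ →L[ℂ] L2 γ => R (ket (e.symm (s, b))) (e.symm (t, b))) hST
  simpa only [ampl_ket, Equiv.apply_symm_apply, if_true] using h

end Ket

section HaagDuality
variable {F G : Finset ℤ}

/-- The configuration that agrees with `β` on `F` and with `c` elsewhere. -/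
def replaceOn (F : Finset ℤ) (β : ℤ → ℕ) (c : Config) : Config :=
  (splitConfig F).symm (fun i => β i, (splitConfig F c).2)

theorem splitConfig_symm_apply (F : Finset ℤ) (p) (i : ℤ) :
    (splitConfig F).symm p i = if h : i ∈ F then p.1 ⟨i, h⟩ else p.2 ⟨i, h⟩ := by
  classical
  by_cases h : i ∈ F <;> simp [splitConfig, Finsupp.extendDomain, h]

theorem replaceOn_apply (F : Finset ℤ) (β : ℤ → ℕ) (c : Config) (i : ℤ) :
    replaceOn F β c i = if i ∈ F then β i else c i := by
  rw [replaceOn, splitConfig_symm_apply]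
  by_cases h : i ∈ F <;> simp [h, splitConfig]

theorem replaceOn_apply_of_mem {i : ℤ} (hi : i ∈ F) (β : ℤ → ℕ) (c : Config) :
    replaceOn F β c i = β i := by rw [replaceOn_apply, if_pos hi]

theorem replaceOn_apply_of_notMem {i : ℤ} (hi : i ∉ F) (β : ℤ → ℕ) (c : Config) :
    replaceOn F β c i = c i := by rw [replaceOn_apply, if_neg hi]

theorem replaceOn_replaceOn (F : Finset ℤ) (α β : ℤ → ℕ) (c : Config) :
    replaceOn F α (replaceOn F β c) = replaceOn F α c :=
  Finsupp.ext fun i => by simp only [replaceOn_apply]; split_ifs <;> rfl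

theorem replaceOn_eq_self {β : ℤ → ℕ} {c : Config} (h : ∀ i ∈ F, c i = β i) :
    replaceOn F β c = c :=
  Finsupp.ext fun i => by rw [replaceOn_apply]; split_ifs with hi; exacts [(h i hi).symm, rfl]

theorem replaceOn_comm (h : Disjoint F G) (α β : ℤ → ℕ) (c : Config) :
    replaceOn F α (replaceOn G β c) = replaceOn G β (replaceOn F α c) :=
  Finsupp.ext fun i => by
    have : i ∈ F → i ∉ G := fun hi => Finset.disjoint_left.1 h hi
    simp only [replaceOn_apply]; split_ifs <;> tauto

theorem replaceOn_union (F G : Finset ℤ) (β : ℤ → ℕ) (c : Config) :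
    replaceOn (F ∪ G) β c = replaceOn G β (replaceOn F β c) :=
  Finsupp.ext fun i => by
    simp only [replaceOn_apply, Finset.mem_union]; split_ifs <;> tauto

theorem replaceOn_zero_eq_splitConfig_symm (h : Disjoint F G) {c : Config}
    (hc : ∀ i ∉ F, i ∉ G → c i = 0) :
    replaceOn G 0 c = (splitConfig F).symm ((splitConfig F c).1, 0) :=
  Finsupp.ext fun i => by
    have : i ∈ F → i ∉ G := fun hi => Finset.disjoint_left.1 h hi
    rw [splitConfig_symm_apply, replaceOn_apply]
    split_ifs <;> simp_all [splitConfig]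

/-- The operator `|e_α⟩⟨e_β| ⊗ 1` localized in `F`, where `α` and `β` are restricted to `F`. -/
def unitOp (F : Finset ℤ) (α β : ℤ → ℕ) : L2 Config →L[ℂ] L2 Config :=
  ampl (splitConfig F) (matUnit (fun i => α i) (fun i => β i))

theorem unitOp_apply (F : Finset ℤ) (α β : ℤ → ℕ) (ξ : L2 Config) (c : Config) :
    unitOp F α β ξ c = if ∀ i ∈ F, c i = α i then ξ (replaceOn F β c) else 0 := by
  classical
  rw [unitOp, ampl_apply, matUnit_apply, lp.coeFn_smul, Pi.smul_apply, ket_apply]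
  have h : ((splitConfig F c).1 = fun i : F => α i) ↔ ∀ i ∈ F, c i = α i := by
    simp [funext_iff, splitConfig]
  simp only [h, smul_eq_mul, mul_ite, mul_one, mul_zero]
  rfl

theorem unitOp_empty (α β : ℤ → ℕ) : unitOp ∅ α β = 1 := by
  ext ξ c
  rw [unitOp_apply, if_pos (by simp), replaceOn_eq_self (by simp)]
  rfl

theorem unitOp_union (h : Disjoint F G) (α β : ℤ → ℕ) :
    unitOp (F ∪ G) α β = unitOp F α β * unitOp G α β := by
  ext ξ c
  have hG : (∀ i ∈ G, replaceOn F β c i = α i) ↔ ∀ i ∈ G, c i = α i :=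
    forall₂_congr fun i hi => by rw [replaceOn_apply_of_notMem (Finset.disjoint_right.1 h hi)]
  simp only [mul_apply_eq_comp, unitOp_apply, ← ite_and, hG, replaceOn_union, Finset.mem_union,
    or_imp, forall_and]

theorem unitOp_insert {j : ℤ} (hj : j ∉ F) (α β : ℤ → ℕ) :
    unitOp (insert j F) α β = unitOp {j} α β * unitOp F α β := by
  rw [Finset.insert_eq, unitOp_union (Finset.disjoint_singleton_left.2 hj)]

theorem commute_unitOp (h : Disjoint F G) (α β α' β' : ℤ → ℕ) :
    Commute (unitOp F α β) (unitOp G α' β') := by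
  ext ξ c
  have hF : (∀ i ∈ F, replaceOn G β' c i = α i) ↔ ∀ i ∈ F, c i = α i :=
    forall₂_congr fun i hi => by rw [replaceOn_apply_of_notMem (Finset.disjoint_left.1 h hi)]
  have hG : (∀ i ∈ G, replaceOn F β c i = α' i) ↔ ∀ i ∈ G, c i = α' i :=
    forall₂_congr fun i hi => by rw [replaceOn_apply_of_notMem (Finset.disjoint_right.1 h hi)]
  simp only [mul_apply_eq_comp, unitOp_apply, ← ite_and, hF, hG, replaceOn_comm h, and_comm]

theorem unitOp_ket (α : ℤ → ℕ) {β : ℤ → ℕ} {d : Config} (hd : ∀ i ∈ F, d i = β i) :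
    unitOp F α β (ket d) = ket (replaceOn F α d) := by
  classical
  ext c
  rw [unitOp_apply, ket_apply, ket_apply, ← ite_and]
  refine if_congr ⟨fun ⟨hc, hcd⟩ => ?_, fun hcd => ?_⟩ rfl rfl
  · rw [← hcd, replaceOn_replaceOn, replaceOn_eq_self hc]
  · subst hcd
    exact ⟨fun i hi => replaceOn_apply_of_mem hi _ _, by
      rw [replaceOn_replaceOn, replaceOn_eq_self hd]⟩

variable {T : L2 Config →L[ℂ] L2 Config}

theorem commute_unitOp_of_forall_singleton
    (hT : ∀ j ∈ G, ∀ α β : ℤ → ℕ, Commute T (unitOp {j} α β)) (α β : ℤ → ℕ) :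
    Commute T (unitOp G α β) := by
  induction G using Finset.induction_on with
  | empty => rw [unitOp_empty]; exact Commute.one_right T
  | insert j G hj ih =>
    rw [unitOp_insert hj]
    exact (hT j (Finset.mem_insert_self j G) α β).mul_right
      (ih fun i hi => hT i (Finset.mem_insert_of_mem hi))

theorem apply_ket_replaceOn_of_commute {α β : ℤ → ℕ} (hT : Commute T (unitOp G α β))
    {d : Config} (hd : ∀ i ∈ G, d i = β i) (c : Config) :
    T (ket (replaceOn G α d)) c =
      if ∀ i ∈ G, c i = α i then T (ket d) (replaceOn G β c) else 0 := by
  rw [← unitOp_ket α hd, ← unitOp_apply, ← mul_apply_eq_comp, ← mul_apply_eq_comp, hT.eq]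

theorem mem_localOp_of_commute (F : Finset ℤ)
    (hT : ∀ j ∉ F, ∀ α β : ℤ → ℕ, Commute T (unitOp {j} α β)) : T ∈ localOp F := by
  classical
  set e := splitConfig F
  -- `T` does not see the sites outside `F`, so nothing is lost by fixing them in the state `0`.
  refine ⟨sliceCLM e 0 ∘L T ∘L ContinuousLinearMap.adjoint (sliceCLM e 0),
    clm_ext_ket fun d => lp.ext (funext fun c => ?_)⟩
  change ampl e _ (ket d) c = _
  rw [ampl_ket, ContinuousLinearMap.comp_apply, ContinuousLinearMap.comp_apply,
    adjoint_sliceCLM_ket, sliceCLM_apply]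
  split_ifs with hcd
  · set G := (c.support ∪ d.support) \ F
    have hFG : Disjoint F G := Finset.disjoint_sdiff
    have hcomm : Commute T (unitOp G 0 d) := commute_unitOp_of_forall_singleton
      (fun j hj => hT j (Finset.disjoint_right.1 hFG hj)) _ _
    have hcd' : ∀ i ∈ G, c i = d i := fun i hi =>
      DFunLike.congr_fun hcd ⟨i, Finset.disjoint_right.1 hFG hi⟩
    rw [← replaceOn_zero_eq_splitConfig_symm hFG (c := c) (by simp_all [G]),
      ← replaceOn_zero_eq_splitConfig_symm hFG (c := d) (by simp_all [G]),
      apply_ket_replaceOn_of_commute hcomm (fun _ _ => rfl),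
      if_pos fun i hi => replaceOn_apply_of_mem hi 0 c, replaceOn_replaceOn,
      replaceOn_eq_self hcd']
  · obtain ⟨⟨j, hj⟩, hne⟩ : ∃ i : {i : ℤ // i ∉ F}, c i ≠ d i := by
      by_contra! h
      exact hcd (Finsupp.ext h)
    have h := apply_ket_replaceOn_of_commute (hT j hj d d) (fun _ _ => rfl) c
    rw [replaceOn_eq_self fun _ _ => rfl, if_neg (by simpa using hne)] at h
    exact h.symm

end HaagDuality

namespace FGCorr
section Correspondence
variable {A : Type} [CStarAlgebra A] [PartialOrder A] {X Y : FGCorr A}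

theorem inner_ract_left (x y : X) (a : A) :
    X.inner (X.ract (op a) x) y = star a * X.inner x y := by
  rw [← X.star_inner, X.inner_ract, star_mul, X.star_inner]

theorem lin_sum {ι : Type*} (s : Finset ι) (f : ι → (X ⟶ Y)) (x : X) :
    Hom.lin (∑ i ∈ s, f i) x = ∑ i ∈ s, Hom.lin (f i) x :=
  (congrArg (· x) (map_sum (homSubmodule X Y).subtype f s)).trans (LinearMap.sum_apply _ _ _)

theorem smul_eq_lact (z : ℂ) (x : X) : z • x = X.lact (z • 1) x := by
  rw [map_smul, map_one, LinearMap.smul_apply, Module.End.one_apply]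

theorem smul_eq_ract (z : ℂ) (x : X) : z • x = X.ract (op (z • 1)) x := by
  rw [op_smul, map_smul, op_one, map_one, LinearMap.smul_apply, Module.End.one_apply]

variable [StarOrderedRing A]

/-- The elements `a` of `A` with `a x = x a`. -/
def commutant (x : X) : Subalgebra ℂ A where
  carrier := {a | X.lact a x = X.ract (op a) x}
  mul_mem' := fun {a b} ha hb => by
    change X.lact (a * b) x = X.ract (op (a * b)) x
    rw [X.lact_mul_apply, X.ract_mul_apply, hb, X.lact_ract, ha]
  add_mem' := fun {a b} ha hb => by
    change X.lact (a + b) x = X.ract (op (a + b)) x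
    rw [X.lact_add_apply, X.ract_add_apply, hb, ha]
  algebraMap_mem' z := by
    change X.lact (algebraMap ℂ A z) x = X.ract (op (algebraMap ℂ A z)) x
    rw [← MulOpposite.algebraMap_apply, AlgHom.commutes, AlgHom.commutes]

theorem mem_commutant {x : X} {a : A} : a ∈ commutant x ↔ X.lact a x = X.ract (op a) x := Iff.rfl

theorem commute_inner {x y : X} {a : A} (hx : star a ∈ commutant x) (hy : a ∈ commutant y) :
    X.inner x y * a = a * X.inner x y := by
  rw [← X.inner_ract, ← mem_commutant.1 hy, ← star_star a, ← X.inner_lact, mem_commutant.1 hx,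
    inner_ract_left]

theorem mem_commutant_toUnit {a b : A} :
    b ∈ commutant (X := unit A) (toUnit a) ↔ b * a = a * b := Iff.rfl

/-- The positive map `a ↦ ⟨x, a x⟩`. -/
def vectorMap (x : X) : A →ₚ[ℂ] A :=
  .mk₀ ((X.inner x).comp (X.lact.toLinearMap.flip x)) fun a ha => by
    obtain ⟨c, rfl⟩ := CStarAlgebra.nonneg_iff_eq_star_mul_self.1 ha
    change 0 ≤ X.inner x (X.lact (star c * c) x)
    rw [X.lact_mul_apply, ← X.inner_lact]
    exact X.inner_self_nonneg _

theorem vectorMap_apply (x : X) (a : A) : vectorMap x a = X.inner x (X.lact a x) := rfl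

theorem inner_commutator_self (a : A) (x : X) :
    X.inner (X.lact a x - X.ract (op a) x) (X.lact a x - X.ract (op a) x) =
      vectorMap x (star a * a) - vectorMap x (star a) * a -
        (star a * vectorMap x a - star a * (vectorMap x 1 * a)) := by
  simp only [vectorMap_apply, map_sub, LinearMap.sub_apply, inner_ract_left, X.inner_ract,
    X.inner_lact, X.lact_mul_apply, map_one, Module.End.one_apply]
  rw [mul_assoc, sub_sub_sub_comm]

theorem isClosed_commutant (x : X) : IsClosed (commutant x : Set A) := by
  have hcont : Continuous (vectorMap x) := map_continuous (vectorMap x)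
  have hzero : (commutant x : Set A) = {a | X.inner (X.lact a x - X.ract (op a) x)
      (X.lact a x - X.ract (op a) x) = 0} := Set.ext fun a =>
    ⟨fun ha => by rw [Set.mem_ofPred_eq, mem_commutant.1 ha, sub_self, map_zero],
      fun ha => sub_eq_zero.1 (X.inner_self_eq_zero _ ha)⟩
  simp only [hzero, inner_commutator_self]
  exact isClosed_eq (by fun_prop) continuous_const

/-- The elements `a` of `A` with `a x = x a` and `a* x = x a*`. -/
def starCommutant (x : X) : StarSubalgebra ℂ A where
  carrier := {a | a ∈ commutant x ∧ star a ∈ commutant x}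
  mul_mem' ha hb := ⟨mul_mem ha.1 hb.1, by rw [star_mul]; exact mul_mem hb.2 ha.2⟩
  add_mem' ha hb := ⟨add_mem ha.1 hb.1, by rw [star_add]; exact add_mem ha.2 hb.2⟩
  algebraMap_mem' z := ⟨Subalgebra.algebraMap_mem _ z, by
    rw [← algebraMap_star_comm]; exact Subalgebra.algebraMap_mem _ _⟩
  star_mem' ha := ⟨ha.2, by rw [star_star]; exact ha.1⟩

theorem isClosed_starCommutant (x : X) : IsClosed (starCommutant x : Set A) :=
  (isClosed_commutant x).inter ((isClosed_commutant x).preimage continuous_star)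

theorem le_starCommutant {B : StarSubalgebra ℂ A} {x : X} (h : ∀ a ∈ B, a ∈ commutant x) :
    B ≤ starCommutant x := fun _ ha => ⟨h _ ha, h _ (star_mem ha)⟩

theorem isLocalized_iff {loc : Finset ℤ → StarSubalgebra ℂ A} {I : Finset ℤ} {x : X} :
    IsLocalized loc I x ↔ complAlg loc I ≤ starCommutant x :=
  ⟨fun h => le_starCommutant h, fun h _ ha => (h ha).1⟩

theorem isLocalized_of_forall_Icc {loc : Finset ℤ → StarSubalgebra ℂ A} {I : Finset ℤ} {x : X}
    (h : ∀ p q, Disjoint (Finset.Icc p q) I → loc (Finset.Icc p q) ≤ starCommutant x) :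
    IsLocalized loc I x :=
  isLocalized_iff.2 (StarSubalgebra.topologicalClosure_minimal
    (iSup_le fun p => iSup_le fun q => iSup_le fun hpq => h p q hpq) (isClosed_starCommutant x))

end Correspondence
end FGCorr

open FGCorr

section QuasiLocal
variable {p q : ℤ} {X : FGCorr LInf} {x y : X}

theorem isClosed_quasiLocal : IsClosed (quasiLocal : Set (L2 Config →L[ℂ] L2 Config)) :=
  StarSubalgebra.isClosed_topologicalClosure _

theorem incl_injective : Function.Injective LInf.incl := Subtype.val_injective

theorem localOp_le_quasiLocal (p q : ℤ) : localOp (Finset.Icc p q) ≤ quasiLocal :=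
  (le_iSup₂ (f := fun p q => localOp (Finset.Icc p q)) p q).trans
    (StarSubalgebra.le_topologicalClosure _)

/-- The embedding `B(ℓ²(ℕ)^{⊗I}) → L^∞` of the local algebra of `I = [p, q]`. -/
def LInf.embed (p q : ℤ) :
    (L2 (Finset.Icc p q → ℕ) →L[ℂ] L2 (Finset.Icc p q → ℕ)) →⋆ₐ[ℂ] LInf :=
  StarAlgHom.codRestrict (ampl (splitConfig (Finset.Icc p q))) quasiLocal
    fun S => localOp_le_quasiLocal p q ⟨S, rfl⟩

theorem embed_injective (p q : ℤ) : Function.Injective (LInf.embed p q) := fun _ _ h =>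
  ampl_injective (splitConfig (Finset.Icc p q)) (congrArg LInf.incl h)

theorem continuous_embed (p q : ℤ) : Continuous (LInf.embed p q) :=
  AddMonoidHomClass.continuous_of_bound (LInf.embed p q) 1 fun S => by
    rw [one_mul]; exact NonUnitalStarAlgHom.norm_apply_le (LInf.embed p q) S

theorem mem_loc_Icc_iff {a : LInf} :
    a ∈ LInf.loc (Finset.Icc p q) ↔ ∃ S, LInf.embed p q S = a :=
  ⟨fun ⟨S, hS⟩ => ⟨S, incl_injective hS⟩, fun ⟨S, hS⟩ => ⟨S, congrArg LInf.incl hS⟩⟩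

theorem unitOp_mem_localOp {F G : Finset ℤ} (h : G ⊆ F) (α β : ℤ → ℕ) :
    unitOp G α β ∈ localOp F :=
  mem_localOp_of_commute F fun _ hj _ _ =>
    commute_unitOp (Finset.disjoint_singleton_right.2 fun hjG => hj (h hjG)) _ _ _ _

theorem unitOp_mem_quasiLocal (F : Finset ℤ) (α β : ℤ → ℕ) : unitOp F α β ∈ quasiLocal := by
  obtain ⟨p, hp⟩ := F.bddBelow
  obtain ⟨q, hq⟩ := F.bddAbove
  exact localOp_le_quasiLocal p q
    (unitOp_mem_localOp (fun i hi => Finset.mem_Icc.2 ⟨hp hi, hq hi⟩) α β)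

/-- The matrix unit `|e_α⟩⟨e_β|` at the sites in `F`, as an element of `L^∞`. -/
def localUnit (F : Finset ℤ) (α β : ℤ → ℕ) : LInf := ⟨unitOp F α β, unitOp_mem_quasiLocal F α β⟩

theorem localUnit_mem_loc {F G : Finset ℤ} (h : G ⊆ F) (α β : ℤ → ℕ) :
    localUnit G α β ∈ LInf.loc F := unitOp_mem_localOp h α β

theorem localUnit_empty (α β : ℤ → ℕ) : localUnit ∅ α β = 1 := incl_injective (unitOp_empty α β)

theorem localUnit_insert {F : Finset ℤ} {j : ℤ} (hj : j ∉ F) (α β : ℤ → ℕ) :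
    localUnit (insert j F) α β = localUnit {j} α β * localUnit F α β :=
  incl_injective (unitOp_insert hj α β)

theorem commute_localUnit {F G : Finset ℤ} (h : Disjoint F G) (α β α' β' : ℤ → ℕ) :
    Commute (localUnit F α β) (localUnit G α' β') :=
  incl_injective (commute_unitOp h α β α' β')

theorem exists_localUnit_eq_embed_matUnit (s t : Finset.Icc p q → ℕ) :
    ∃ α β, localUnit (Finset.Icc p q) α β = LInf.embed p q (matUnit s t) := by
  have hext (u : Finset.Icc p q → ℕ) : ∃ γ : ℤ → ℕ, (fun i : Finset.Icc p q => γ i) = u :=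
    ⟨fun i => if hi : i ∈ Finset.Icc p q then u ⟨i, hi⟩ else 0, funext fun i => dif_pos i.2⟩
  obtain ⟨α, rfl⟩ := hext s
  obtain ⟨β, rfl⟩ := hext t
  exact ⟨α, β, rfl⟩

theorem localUnit_mem_commutant {F : Finset ℤ}
    (h : ∀ j ∈ F, ∀ α β, localUnit {j} α β ∈ commutant x) (α β : ℤ → ℕ) :
    localUnit F α β ∈ commutant x := by
  induction F using Finset.induction_on with
  | empty => rw [localUnit_empty]; exact one_mem _
  | insert j F hj ih =>
    rw [localUnit_insert hj]
    exact mul_mem (h j (Finset.mem_insert_self j F) α β)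
      (ih fun i hi => h i (Finset.mem_insert_of_mem hi))

theorem embed_rankOne_mem_commutant
    (h : ∀ s t, LInf.embed p q (matUnit s t) ∈ commutant x) (f : L2 (Finset.Icc p q → ℕ))
    (t : Finset.Icc p q → ℕ) :
    LInf.embed p q (InnerProductSpace.rankOne ℂ f (ket t)) ∈ commutant x := by
  let φ : L2 (Finset.Icc p q → ℕ) →ₗ[ℂ] LInf :=
    { toFun := fun g => LInf.embed p q (InnerProductSpace.rankOne ℂ g (ket t))
      map_add' := fun g g' => by rw [map_add, add_apply, map_add]
      map_smul' := fun z g => by rw [map_smul, smul_apply, map_smul, RingHom.id_apply] }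
  have hφ : Continuous φ := (continuous_embed p q).comp (by fun_prop)
  have hspan : Submodule.span ℂ (Set.range ket) ≤
      (Subalgebra.toSubmodule (commutant x)).comap φ :=
    Submodule.span_le.2 (Set.range_subset_iff.2 fun s => h s t)
  exact closure_minimal hspan ((isClosed_commutant x).preimage hφ) (dense_span_ket f)

theorem eq_zero_of_ract_matUnit_eq_zero
    (h : ∀ s, X.ract (op (LInf.embed p q (matUnit s s))) x = 0) : x = 0 := by
  refine X.inner_self_eq_zero x (incl_injective ?_)
  rw [map_zero]
  refine clm_ext_ket fun d => ?_
  have hT : X.inner x x * LInf.embed p q (matUnit (fun i => d i) fun i => d i) = 0 := by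
    rw [← X.inner_ract, h, map_zero]
  have hd : unitOp (Finset.Icc p q) d d (ket d) = ket d := by
    rw [unitOp_ket _ fun _ _ => rfl, replaceOn_eq_self fun _ _ => rfl]
  rw [← hd]
  exact congrArg (fun T => LInf.incl T (ket d)) hT

theorem loc_le_starCommutant (h : ∀ j ∈ Finset.Icc p q, ∀ α β, localUnit {j} α β ∈ commutant x) :
    LInf.loc (Finset.Icc p q) ≤ starCommutant x := by
  have hmat (s t) : LInf.embed p q (matUnit s t) ∈ commutant x := by
    obtain ⟨α, β, hαβ⟩ := exists_localUnit_eq_embed_matUnit s t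
    exact hαβ ▸ localUnit_mem_commutant h α β
  refine le_starCommutant fun a ha => ?_
  obtain ⟨S, rfl⟩ := mem_loc_Icc_iff.1 ha
  refine sub_eq_zero.1 (eq_zero_of_ract_matUnit_eq_zero (p := p) (q := q) fun s => ?_)
  have hS : LInf.embed p q S * LInf.embed p q (matUnit s s) ∈ commutant x := by
    rw [← map_mul, show S * matUnit s s = InnerProductSpace.rankOne ℂ (S (ket s)) (ket s) from
      ContinuousLinearMap.ext fun f => by simp [matUnit]]
    exact embed_rankOne_mem_commutant hmat _ _
  rw [map_sub, ← X.lact_ract, ← mem_commutant.1 (hmat s s), ← X.lact_mul_apply,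
    ← X.ract_mul_apply, mem_commutant.1 hS, sub_self]

theorem commute_of_mem_loc_Icc {r s : ℤ} (h : Disjoint (Finset.Icc p q) (Finset.Icc r s))
    {a b : LInf} (ha : a ∈ LInf.loc (Finset.Icc p q)) (hb : b ∈ LInf.loc (Finset.Icc r s)) :
    a * b = b * a := by
  have hunit : ∀ j ∈ Finset.Icc r s, ∀ α β, a * localUnit {j} α β = localUnit {j} α β * a :=
    fun j hj α β => (loc_le_starCommutant (X := unit LInf) (x := toUnit (localUnit {j} α β))
      (fun i hi α' β' => mem_commutant_toUnit.2 (commute_localUnit (Finset.disjoint_singleton.2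
        (Finset.disjoint_iff_ne.1 h i hi j hj)) α' β' α β).eq) ha).1
  exact ((loc_le_starCommutant (X := unit LInf) (x := toUnit a)
    (fun j hj α β => (hunit j hj α β).symm) hb).1 : b * a = a * b).symm

theorem complAlg_commute {a b : LInf} (ha : a ∈ LInf.loc (Finset.Icc p q))
    (hb : b ∈ complAlg LInf.loc (Finset.Icc p q)) : b * a = a * b :=
  isLocalized_of_forall_Icc (X := unit LInf) (x := toUnit a)
    (fun _ _ hrs => le_starCommutant fun _ hc => commute_of_mem_loc_Icc hrs hc ha) b hb

theorem loc_le_complAlg {I : Finset ℤ} (h : Disjoint (Finset.Icc p q) I) :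
    LInf.loc (Finset.Icc p q) ≤ complAlg LInf.loc I :=
  (le_iSup₂_of_le (f := fun p q => ⨆ (_ : Disjoint (Finset.Icc p q) I), LInf.loc (Finset.Icc p q))
    p q (le_iSup (fun _ => LInf.loc (Finset.Icc p q)) h)).trans
    (StarSubalgebra.le_topologicalClosure _)

theorem localUnit_singleton_mem_complAlg {j : ℤ} {I : Finset ℤ} (h : j ∉ I) (α β) :
    localUnit {j} α β ∈ complAlg LInf.loc I :=
  loc_le_complAlg (p := j) (q := j) (by rwa [Finset.Icc_self, Finset.disjoint_singleton_left])
    (localUnit_mem_loc (by rw [Finset.Icc_self]) α β)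

theorem mem_loc_of_commute {I : Finset ℤ} {a : LInf}
    (h : ∀ b ∈ complAlg LInf.loc I, a * b = b * a) : a ∈ LInf.loc I :=
  mem_localOp_of_commute I fun _ hj α β =>
    congrArg LInf.incl (h _ (localUnit_singleton_mem_complAlg hj α β))

theorem inner_mem_loc {I : Finset ℤ} (hx : IsLocalized LInf.loc I x)
    (hy : IsLocalized LInf.loc I y) : X.inner x y ∈ LInf.loc I :=
  mem_loc_of_commute fun b hb => commute_inner (hx _ (star_mem hb)) (hy b hb)

theorem mem_commutant_of_forall_loc (h : ∀ p q, LInf.loc (Finset.Icc p q) ≤ starCommutant x)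
    (a : LInf) : a ∈ commutant x := by
  have hemb : Topology.IsClosedEmbedding LInf.incl :=
    isClosed_quasiLocal.isClosedEmbedding_subtypeVal
  have hle : quasiLocal ≤ (starCommutant x).map LInf.incl :=
    StarSubalgebra.topologicalClosure_minimal
      (iSup_le fun p => iSup_le fun q => fun T hT =>
        ⟨⟨T, localOp_le_quasiLocal p q hT⟩, h p q hT, rfl⟩)
      (hemb.isClosedMap _ (isClosed_starCommutant x))
  obtain ⟨b, hb, hba⟩ := hle a.2
  exact incl_injective hba ▸ hb.1

theorem mem_commutant_of_isLocalized {I : Finset ℤ} (hx : IsLocalized LInf.loc I x)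
    (h : ∀ a ∈ LInf.loc I, a ∈ commutant x) (a : LInf) : a ∈ commutant x := by
  refine mem_commutant_of_forall_loc (fun p q => loc_le_starCommutant fun j _ α β => ?_) a
  by_cases hj : j ∈ I
  · exact h _ (localUnit_mem_loc (Finset.singleton_subset_iff.2 hj) α β)
  · exact hx _ (localUnit_singleton_mem_complAlg hj α β)

/-- The vacuum state, which is the vector state of `e_0`. -/
def vac : LInf →ₗ[ℂ] ℂ where
  toFun a := ⟪ket 0, LInf.incl a (ket 0)⟫_ℂ
  map_add' a b := by simp
  map_smul' z a := by simp

theorem vac_one : vac 1 = 1 := by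
  change ⟪ket 0, LInf.incl 1 (ket 0)⟫_ℂ = 1
  rw [map_one, one_apply_eq_self, inner_self_eq_norm_sq_to_K, norm_ket]
  simp

theorem vac_star (a : LInf) : vac (star a) = star (vac a) := by
  change ⟪ket 0, LInf.incl (star a) (ket 0)⟫_ℂ = starRingEnd ℂ ⟪ket 0, LInf.incl a (ket 0)⟫_ℂ
  rw [map_star, inner_conj_symm, ContinuousLinearMap.star_eq_adjoint,
    ContinuousLinearMap.adjoint_inner_right]

theorem vac_star_mul_self_nonneg (a : LInf) : 0 ≤ (vac (star a * a)).re := by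
  have hvac : vac (star a * a) = ⟪LInf.incl a (ket 0), LInf.incl a (ket 0)⟫_ℂ := by
    change ⟪ket 0, LInf.incl (star a * a) (ket 0)⟫_ℂ = _
    rw [map_mul, map_star, mul_apply_eq_comp, ContinuousLinearMap.star_eq_adjoint,
      ContinuousLinearMap.adjoint_inner_right]
  rw [hvac]
  exact inner_self_nonneg (𝕜 := ℂ)

theorem eq_vac_smul_one_of_central {a : LInf} (h : ∀ b, a * b = b * a) : a = vac a • 1 := by
  -- By Haag duality `a` is localized in the empty interval `[1, 0]`.
  obtain ⟨S, rfl⟩ := mem_loc_Icc_iff.1 (mem_loc_of_commute (I := Finset.Icc 1 0) fun b _ => h b)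
  have : IsEmpty (Finset.Icc (1 : ℤ) 0) := ⟨fun i => by simpa using i.2⟩
  have hS : S = S (ket isEmptyElim) isEmptyElim • 1 := clm_ext_ket fun s => by
    classical
    refine lp.ext (funext fun t => ?_)
    rw [Subsingleton.elim s isEmptyElim, Subsingleton.elim t isEmptyElim]
    simp [ket_apply]
  rw [hS, map_smul, map_one, map_smul, vac_one]
  simp

end QuasiLocal

section AlmostDisjoint
variable {S : Type}

theorem exists_almost_disjoint (S : Type) [Countable S] [Infinite S] :
    ∃ f : Set ℕ → S → S, (∀ A, Function.Injective (f A)) ∧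
      Pairwise fun A B => {p : S × S | f A p.1 = f B p.2}.Finite := by
  obtain ⟨e⟩ : Nonempty (S ≃ ℕ) := nonempty_equiv_of_countable
  obtain ⟨code, hcode⟩ := exists_injective_nat (Σ n : ℕ, (Fin n → Prop))
  refine ⟨fun A s => e.symm (code ⟨e s, fun i => ↑i ∈ A⟩), fun A s t h => ?_, fun A B hAB => ?_⟩
  · exact e.injective (congrArg Sigma.fst (hcode (e.symm.injective h)))
  obtain ⟨k, hk⟩ : ∃ k, ¬(k ∈ A ↔ k ∈ B) := by simpa [Set.ext_iff] using hAB
  refine ((Set.finite_Iic k).image fun n => (e.symm n, e.symm n)).subset ?_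
  rintro ⟨s, t⟩ h
  have hprefix := hcode (e.symm.injective h)
  obtain rfl : s = t := e.injective (congrArg Sigma.fst hprefix)
  refine ⟨e s, ?_, by simp⟩
  by_contra hks
  exact hk (congrFun (eq_of_heq (Sigma.mk.inj hprefix).2) ⟨k, not_le.1 hks⟩).to_iff

/-- The isometry `e_s ↦ e_{f s}`. -/
def ketIsometry (f : S → S) (hf : Function.Injective f) : L2 S →ₗᵢ[ℂ] L2 S :=
  (orthonormal_ket.comp f hf).orthogonalFamily.linearIsometry

theorem ketIsometry_ket (f : S → S) (hf : Function.Injective f) (s : S) :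
    ketIsometry f hf (ket s) = ket (f s) := by
  classical
  rw [ket, ← (ketBasis S).repr_symm_single]
  refine ((orthonormal_ket.comp f hf).orthogonalFamily.linearIsometry_apply_single
    (i := s) (1 : ℂ)).trans ?_
  rw [LinearIsometry.toSpanSingleton_apply, one_smul, Function.comp_apply]

theorem star_ketIsometry_mul_self (f : S → S) (hf : Function.Injective f) :
    star (ketIsometry f hf).toContinuousLinearMap * (ketIsometry f hf).toContinuousLinearMap = 1 :=
  (ContinuousLinearMap.norm_map_iff_adjoint_comp_self _).1 (ketIsometry f hf).norm_map

theorem star_ketIsometry_mul_ketIsometry {f g : S → S} (hf : Function.Injective f)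
    (hg : Function.Injective g) (h : {p : S × S | f p.1 = g p.2}.Finite) :
    star (ketIsometry f hf).toContinuousLinearMap * (ketIsometry g hg).toContinuousLinearMap =
      ∑ p ∈ h.toFinset, matUnit p.1 p.2 := by
  classical
  refine clm_ext_ket fun s => lp.ext (funext fun t => ?_)
  have hunit (p : S × S) : (matUnit p.1 p.2 (ket s) : L2 S) t = if p = (t, s) then 1 else 0 := by
    rw [matUnit_apply, lp.coeFn_smul, Pi.smul_apply, ket_apply, ket_apply]
    simp only [Prod.ext_iff]
    split_ifs <;> simp_all
  rw [mul_apply_eq_comp, ← inner_ket, ContinuousLinearMap.star_eq_adjoint,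
    ContinuousLinearMap.adjoint_inner_right, sum_apply, lp.coeFn_sum, Finset.sum_apply]
  simp only [LinearIsometry.coe_toContinuousLinearMap, ketIsometry_ket, inner_ket, ket_apply,
    hunit, Finset.sum_ite_eq', Set.Finite.mem_toFinset, Set.mem_ofPred_eq]

theorem separableSpace_L2 (S : Type) [Countable S] :
    TopologicalSpace.SeparableSpace (L2 S) := by
  rw [← TopologicalSpace.isSeparable_univ_iff, ← (dense_span_ket (α := S)).closure_eq]
  exact ((Set.countable_range ket).isSeparable.span (R := ℂ)).closure

end AlmostDisjoint

theorem countable_of_pairwise_inner_eq_zero {E ι : Type*} [NormedAddCommGroup E]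
    [InnerProductSpace ℂ E] [TopologicalSpace.SeparableSpace E] {w : ι → E} (hw : ∀ i, w i ≠ 0)
    (horth : Pairwise fun i j => ⟪w i, w j⟫_ℂ = 0) : Countable ι := by
  refine Pairwise.countable_of_isOpen_disjoint (s := fun i => Metric.ball (w i) (‖w i‖ / 2))
    (fun i j hij => Metric.ball_disjoint_ball ?_) (fun i => Metric.isOpen_ball)
    fun i => ⟨w i, Metric.mem_ball_self (half_pos (norm_pos_iff.2 (hw i)))⟩
  have hdist : ‖w i - w j‖ ^ 2 = ‖w i‖ ^ 2 + ‖w j‖ ^ 2 := by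
    rw [@norm_sub_sq ℂ, horth hij, map_zero, mul_zero, sub_zero]
  rw [dist_eq_norm]
  nlinarith [norm_nonneg (w i - w j), norm_nonneg (w i), norm_nonneg (w j),
    sq_nonneg (‖w i‖ - ‖w j‖)]

section Rep
open InnerProductSpace (rankOne)

theorem rankOne_mul_rankOne {H : Type*} [NormedAddCommGroup H] [InnerProductSpace ℂ H] {o : H}
    (ho : ‖o‖ = 1) (h k : H) : rankOne ℂ h o * rankOne ℂ o k = rankOne ℂ h k := by
  refine (InnerProductSpace.rankOne_comp_rankOne h o o k).trans ?_
  rw [inner_self_eq_norm_sq_to_K, ho, RCLike.ofReal_one, one_pow, one_smul]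

/-- A `⋆`-representation of the bounded operators on a Hilbert space `H` on the inner product space
`E`. It need not be unital, and no continuity is imposed on it or on the operators in its range. -/
structure IsStarRep {H E : Type*} [NormedAddCommGroup H] [InnerProductSpace ℂ H] [CompleteSpace H]
    [NormedAddCommGroup E] [InnerProductSpace ℂ E]
    (π : (H →L[ℂ] H) →ₗ[ℂ] Module.End ℂ E) : Prop where
  map_mul (a b : H →L[ℂ] H) : π (a * b) = π a * π b
  inner_map (a : H →L[ℂ] H) (u v : E) : ⟪π a u, v⟫_ℂ = ⟪u, π (star a) v⟫_ℂ

namespace IsStarRep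
variable {H E : Type*} [NormedAddCommGroup H] [InnerProductSpace ℂ H] [CompleteSpace H]
  [NormedAddCommGroup E] [InnerProductSpace ℂ E] {π : (H →L[ℂ] H) →ₗ[ℂ] Module.End ℂ E}

theorem map_mul_apply (hπ : IsStarRep π) (a b : H →L[ℂ] H) (u : E) :
    π (a * b) u = π a (π b u) := by rw [hπ.map_mul, Module.End.mul_apply]

theorem inner_rankOne (hπ : IsStarRep π) (o h k : H) (v : E) {w : E}
    (hw : π (rankOne ℂ o o) w = w) :
    ⟪π (rankOne ℂ h o) v, π (rankOne ℂ k o) w⟫_ℂ = ⟪h, k⟫_ℂ * ⟪v, w⟫_ℂ := by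
  have hmul : rankOne ℂ o h * rankOne ℂ k o = ⟪h, k⟫_ℂ • rankOne ℂ o o :=
    InnerProductSpace.rankOne_comp_rankOne o h k o
  rw [hπ.inner_map, ContinuousLinearMap.star_eq_adjoint, InnerProductSpace.adjoint_rankOne,
    ← hπ.map_mul_apply, hmul, map_smul, LinearMap.smul_apply, hw, inner_smul_right]

theorem norm_rankOne (hπ : IsStarRep π) {o : H} {v : E} (hv : π (rankOne ℂ o o) v = v) (h : H) :
    ‖π (rankOne ℂ h o) v‖ = ‖v‖ * ‖h‖ := by
  have hinner := hπ.inner_rankOne o h h v hv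
  simp only [inner_self_eq_norm_sq_to_K, ← RCLike.ofReal_pow, ← RCLike.ofReal_mul,
    RCLike.ofReal_inj] at hinner
  rw [← sq_eq_sq₀ (norm_nonneg _) (by positivity), hinner, mul_pow, mul_comm]

/-- The intertwiner `h ↦ π (|h⟩⟨o|) v` from the defining representation on `H` to `π`, for a vector
`v` in the range of `π (|o⟩⟨o|)`. -/
def intertwiner (hπ : IsStarRep π) (o : H) {v : E} (hv : π (rankOne ℂ o o) v = v) : H →L[ℂ] E :=
  LinearMap.mkContinuous
    { toFun h := π (rankOne ℂ h o) v
      map_add' h k := by rw [map_add, add_apply, map_add, LinearMap.add_apply]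
      map_smul' z h := by rw [map_smul, smul_apply, map_smul, LinearMap.smul_apply]; rfl }
    ‖v‖ fun h => (hπ.norm_rankOne hv h).le

variable (hπ : IsStarRep π) (o : H) {v w : E} (hv : π (rankOne ℂ o o) v = v)
include hπ

theorem intertwiner_apply (h : H) : hπ.intertwiner o hv h = π (rankOne ℂ h o) v := rfl

theorem map_intertwiner (a : H →L[ℂ] H) (h : H) :
    π a (hπ.intertwiner o hv h) = hπ.intertwiner o hv (a h) := by
  rw [intertwiner_apply, intertwiner_apply, ← hπ.map_mul_apply]
  exact congrArg (fun T => π T v) (InnerProductSpace.comp_rankOne h o a)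

theorem inner_intertwiner (hw : π (rankOne ℂ o o) w = w) (h k : H) :
    ⟪hπ.intertwiner o hv h, hπ.intertwiner o hw k⟫_ℂ = ⟪h, k⟫_ℂ * ⟪v, w⟫_ℂ :=
  hπ.inner_rankOne o h k v hw

theorem inner_intertwiner_left (u : E) (h : H) :
    ⟪hπ.intertwiner o hv h, u⟫_ℂ = ⟪v, π (rankOne ℂ o h) u⟫_ℂ := by
  rw [intertwiner_apply, hπ.inner_map, ContinuousLinearMap.star_eq_adjoint,
    InnerProductSpace.adjoint_rankOne]

variable [CompleteSpace E] {o}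

theorem map_rankOne_eq_sum (ho : ‖o‖ = 1) {ι : Type*} [Fintype ι] {v : ι → E}
    (hv : ∀ n, π (rankOne ℂ o o) (v n) = v n)
    (hspan : ∀ u, π (rankOne ℂ o o) u = u → u = ∑ n, ⟪v n, u⟫_ℂ • v n) (h k : H) (u : E) :
    π (rankOne ℂ h k) u = π (rankOne ℂ h k) (∑ n, hπ.intertwiner o (hv n)
      (ContinuousLinearMap.adjoint (hπ.intertwiner o (hv n)) u)) := by
  have hfix : π (rankOne ℂ o o) (π (rankOne ℂ o k) u) = π (rankOne ℂ o k) u := by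
    rw [← hπ.map_mul_apply, rankOne_mul_rankOne ho]
  rw [← rankOne_mul_rankOne ho, hπ.map_mul_apply, hspan _ hfix, map_sum, map_sum,
    rankOne_mul_rankOne ho]
  refine Finset.sum_congr rfl fun n _ => ?_
  rw [hπ.map_intertwiner, InnerProductSpace.rankOne_apply, map_smul, map_smul, intertwiner_apply,
    ContinuousLinearMap.adjoint_inner_right, hπ.inner_intertwiner_left]

end IsStarRep

namespace IsStarRep
variable {S : Type} {E : Type*} [Countable S] [Infinite S] [NormedAddCommGroup E]
  [InnerProductSpace ℂ E] [TopologicalSpace.SeparableSpace E]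
  {π : (L2 S →L[ℂ] L2 S) →ₗ[ℂ] Module.End ℂ E} (hπ : IsStarRep π)
include hπ

/- Otherwise an uncountable family of isometries of `ℓ²(S)` with almost disjoint ranges would map
`u` to an uncountable orthogonal family of nonzero vectors. -/
theorem map_one_eq_zero {u : E} (hu : ∀ s t, π (matUnit s t) u = 0) : π 1 u = 0 := by
  by_contra hne
  obtain ⟨f, hf, hfin⟩ := exists_almost_disjoint S
  let T (A : Set ℕ) : L2 S →L[ℂ] L2 S := (ketIsometry (f A) (hf A)).toContinuousLinearMap
  have hT (A B) : π (star (T A)) (π (T B) u) = π (star (T A) * T B) u :=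
    (hπ.map_mul_apply _ _ u).symm
  have hnonzero (A) : π (T A) u ≠ 0 := fun h => hne <| by
    rw [← star_ketIsometry_mul_self (f A) (hf A), ← hT, h, map_zero]
  have horth : Pairwise fun A B => ⟪π (T A) u, π (T B) u⟫_ℂ = 0 := fun A B hAB => by
    beta_reduce
    rw [hπ.inner_map, hT, star_ketIsometry_mul_ketIsometry _ _ (hfin hAB), map_sum,
      LinearMap.sum_apply, Finset.sum_eq_zero fun p _ => hu p.1 p.2, inner_zero_right]
  have := countable_of_pairwise_inner_eq_zero hnonzero horth
  obtain ⟨g, hg⟩ := exists_surjective_nat (Set ℕ)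
  exact Function.cantor_surjective g hg

theorem map_one_eq_sum [CompleteSpace E] {o : L2 S} (ho : ‖o‖ = 1) {ι : Type*} [Fintype ι]
    {v : ι → E} (hv : ∀ n, π (rankOne ℂ o o) (v n) = v n)
    (hspan : ∀ u, π (rankOne ℂ o o) u = u → u = ∑ n, ⟪v n, u⟫_ℂ • v n) (u : E) :
    π 1 u = ∑ n, hπ.intertwiner o (hv n)
      (ContinuousLinearMap.adjoint (hπ.intertwiner o (hv n)) u) := by
  have hsum : π 1 (∑ n, hπ.intertwiner o (hv n)
      (ContinuousLinearMap.adjoint (hπ.intertwiner o (hv n)) u)) = ∑ n, hπ.intertwiner o (hv n)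
      (ContinuousLinearMap.adjoint (hπ.intertwiner o (hv n)) u) := by
    simp only [map_sum, hπ.map_intertwiner, one_apply_eq_self]
  rw [← sub_eq_zero, ← hsum, ← map_sub]
  refine hπ.map_one_eq_zero fun s t => ?_
  rw [map_sub, sub_eq_zero]
  exact hπ.map_rankOne_eq_sum ho hv hspan _ _ u

end IsStarRep
end Rep

namespace FGCorr
section Center
variable {A : Type} [CStarAlgebra A] [PartialOrder A] [StarOrderedRing A] {X Y Z : FGCorr A}

/-- The central vectors of a correspondence: those that commute with every `a : A`. -/
def center (X : FGCorr A) : Submodule ℂ X where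
  carrier := {ξ | ∀ a, a ∈ commutant ξ}
  zero_mem' := fun a => by rw [mem_commutant, map_zero, map_zero]
  add_mem' := fun {ξ η} hξ hη a => by
    rw [mem_commutant, map_add, map_add, mem_commutant.1 (hξ a), mem_commutant.1 (hη a)]
  smul_mem' := fun z ξ hξ a => by
    rw [mem_commutant, map_smul, map_smul, mem_commutant.1 (hξ a)]

theorem mem_center {ξ : X} : ξ ∈ center X ↔ ∀ a, X.lact a ξ = X.ract (op a) ξ := Iff.rfl

theorem inner_lact_of_mem_center {ξ : X} (hξ : ξ ∈ center X) (a : A) (x : X) :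
    X.inner ξ (X.lact a x) = a * X.inner ξ x := by
  rw [← star_star a, ← X.inner_lact, mem_center.1 hξ, inner_ract_left]

theorem tens_ract_of_mem_center {η : Y} (hη : η ∈ center Y) (x : X) (a b : A) :
    tens (X.ract (op a) x) (Y.ract (op b) η) = (tensor X Y).ract (op (a * b)) (tens x η) := by
  rw [ract_tens, Y.lact_ract, mem_center.1 hη, ← Y.ract_mul_apply, ract_tens']

theorem tens_mem_center {ξ : X} {η : Y} (hξ : ξ ∈ center X) (hη : η ∈ center Y) :
    tens ξ η ∈ center (tensor X Y) := fun a => by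
  rw [mem_commutant, lact_tens, mem_center.1 hξ, ract_tens, mem_center.1 hη, ract_tens']

theorem lin_mem_center (f : X ⟶ Y) {ξ : X} (hξ : ξ ∈ center X) : Hom.lin f ξ ∈ center Y :=
  fun a => by rw [mem_commutant, ← lin_lact, mem_center.1 hξ, lin_ract]

theorem lin_eq_inner_dag (f : X ⟶ unit A) (x : X) :
    Hom.lin f x = toUnit (X.inner (Hom.lin (dag f) (toUnit 1)) x) := by
  have h (a : A) : a = star (unitInner a 1) := by rw [unitInner_apply, mul_one, star_star]
  rw [← X.star_inner, ← inner_dag]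
  exact h _

/-- The morphism `a ↦ a ξ` from the unit correspondence given by a central vector `ξ`. -/
def ofCenter {ξ : X} (hξ : ξ ∈ center X) : unit A ⟶ X :=
  mkHom (X.lact.toLinearMap.flip ξ) (fun a b => X.lact_mul_apply a b ξ) fun a b => by
    obtain ⟨a, rfl⟩ := MulOpposite.op_surjective a
    exact (X.lact_mul_apply b a ξ).trans
      ((congrArg (X.lact b) (mem_center.1 hξ a)).trans (X.lact_ract b (op a) ξ))

theorem lin_ofCenter {ξ : X} (hξ : ξ ∈ center X) (a : A) :
    Hom.lin (ofCenter hξ) (toUnit a) = X.lact a ξ := rfl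

theorem lin_ofCenter_one {ξ : X} (hξ : ξ ∈ center X) : Hom.lin (ofCenter hξ) (toUnit 1) = ξ := by
  rw [lin_ofCenter, map_one, Module.End.one_apply]

theorem lin_dag_ofCenter {ξ : X} (hξ : ξ ∈ center X) (x : X) :
    Hom.lin (dag (ofCenter hξ)) x = toUnit (X.inner ξ x) := by
  rw [lin_eq_inner_dag, show dag (dag (ofCenter hξ)) = ofCenter hξ from
    DaggerCategory.dagger_dagger (ofCenter hξ), lin_ofCenter_one]

end Center

section Duality
variable {A : Type} [CStarAlgebra A] [PartialOrder A] [StarOrderedRing A] {X Y : FGCorr A}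

theorem inner_add_inner_le (x y : X) :
    X.inner x y + X.inner y x ≤ X.inner x x + X.inner y y := by
  have h := X.inner_self_nonneg (x - y)
  simp only [map_sub, LinearMap.sub_apply] at h
  rw [← sub_nonneg]
  exact h.trans_eq (by abel)

/-- Families of central vectors that are orthonormal for the `A`-valued inner product. -/
structure IsCentralOrthonormal {ι : Type*} [DecidableEq ι] (ξ : ι → X) : Prop where
  mem_center : ∀ n, ξ n ∈ center X
  inner_eq : ∀ m n, X.inner (ξ m) (ξ n) = if m = n then 1 else 0

namespace IsCentralOrthonormal
variable {ι : Type*} [DecidableEq ι] {ξ : ι → X}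

theorem inner_self (hξ : IsCentralOrthonormal ξ) (n : ι) : X.inner (ξ n) (ξ n) = 1 := by
  rw [hξ.inner_eq, if_pos rfl]

theorem inner_of_ne (hξ : IsCentralOrthonormal ξ) {m n : ι} (h : m ≠ n) :
    X.inner (ξ m) (ξ n) = 0 := by
  rw [hξ.inner_eq, if_neg h]

variable [Fintype ι]

theorem inner_sum_tens_left (hξ : IsCentralOrthonormal ξ) (v w : ι → Y) :
    (tensor X Y).inner (∑ n, tens (ξ n) (v n)) (∑ n, tens (ξ n) (w n)) =
      ∑ n, Y.inner (v n) (w n) := by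
  rw [LinearMap.map_sum₂]
  refine Finset.sum_congr rfl fun m _ => ?_
  rw [map_sum, Fintype.sum_eq_single m fun n hn => by
    rw [inner_tens, hξ.inner_of_ne hn.symm, map_zero, LinearMap.zero_apply, map_zero],
    inner_tens, hξ.inner_self, map_one, Module.End.one_apply]

theorem inner_sum_tens_right (hξ : IsCentralOrthonormal ξ) (v w : ι → Y) :
    (tensor Y X).inner (∑ n, tens (v n) (ξ n)) (∑ n, tens (w n) (ξ n)) =
      ∑ n, Y.inner (v n) (w n) := by
  rw [LinearMap.map_sum₂]
  refine Finset.sum_congr rfl fun m _ => ?_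
  rw [map_sum, Fintype.sum_eq_single m fun n hn => by
    rw [inner_tens, inner_lact_of_mem_center (hξ.mem_center m), hξ.inner_of_ne hn.symm, mul_zero],
    inner_tens, inner_lact_of_mem_center (hξ.mem_center m), hξ.inner_self, mul_one]

end IsCentralOrthonormal

/-- The morphism `y ↦ ε (y ⊗ ξ)` for a central vector `ξ`. -/
def evalRight (ε : tensor Y X ⟶ unit A) {ξ : X} (hξ : ξ ∈ center X) : Y ⟶ unit A :=
  (rightUnit Y).inv ≫ tensorMap (𝟙 Y) (ofCenter hξ) ≫ ε

theorem lin_evalRight (ε : tensor Y X ⟶ unit A) {ξ : X} (hξ : ξ ∈ center X) (y : Y) :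
    Hom.lin (evalRight ε hξ) y = Hom.lin ε (tens y ξ) := by
  change Hom.lin ε (Hom.lin (tensorMap (𝟙 Y) (ofCenter hξ)) (tens y (toUnit 1))) = _
  rw [tensorMap_tens, lin_id, lin_ofCenter_one]

/-- The vector of `Y` that represents `y ↦ ε (y ⊗ ξ)`: the image of `ξ` under the antilinear map
`X → Y` given by `ε`. -/
def dualVec (ε : tensor Y X ⟶ unit A) {ξ : X} (hξ : ξ ∈ center X) : Y :=
  Hom.lin (dag (evalRight ε hξ)) (toUnit 1)

theorem inner_dualVec (ε : tensor Y X ⟶ unit A) {ξ : X} (hξ : ξ ∈ center X) (y : Y) :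
    toUnit (Y.inner (dualVec ε hξ) y) = Hom.lin ε (tens y ξ) := by
  rw [dualVec, ← lin_eq_inner_dag, lin_evalRight]

theorem inner_tens_dualVec (ε : tensor Y X ⟶ unit A) {ξ : X} (hξ : ξ ∈ center X) (x : X)
    (t : tensor X Y) : (tensor X Y).inner (tens x (dualVec ε hξ)) t =
      X.inner x (Hom.lin (rightUnit X).hom (Hom.lin (tensorMap (𝟙 X) ε)
        (Hom.lin (assoc X Y X).hom (tens t ξ)))) := by
  induction t using tens_induction with
  | h1 x' y =>
    rw [inner_tens, assoc_hom_tens, tensorMap_tens, lin_id, ← inner_dualVec ε hξ,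
      rightUnit_hom_tens, X.inner_ract]
    change toUnit _ = _
    rw [inner_dualVec, ← lact_tens, lin_lact, ← inner_dualVec ε hξ]
    rfl
  | h2 t t' h h' => simp only [map_add, add_tens, h, h']

variable {η : unit A ⟶ tensor X Y} {ε : tensor Y X ⟶ unit A}

theorem inner_tens_dualVec_of_zigzag
    (hz : tensorMap η (𝟙 X) ≫ (assoc X Y X).hom ≫ tensorMap (𝟙 X) ε =
      (leftUnit X).hom ≫ (rightUnit X).inv) {ξ : X} (hξ : ξ ∈ center X) (x : X) :
    (tensor X Y).inner (tens x (dualVec ε hξ)) (Hom.lin η (toUnit 1)) = X.inner x ξ := by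
  have h := congrArg (fun g => Hom.lin g (tens (toUnit 1) ξ)) hz
  simp only [lin_comp, tensorMap_tens, lin_id] at h
  rw [inner_tens_dualVec, h, ← lin_comp, Iso.inv_hom_id, lin_id, leftUnit_hom_tens, map_one,
    Module.End.one_apply]

/-- With `vₙ` the dual vectors of `ξₙ` and `D = ∑ ⟨vₙ, vₙ⟩`, both `∑ ξₙ ⊗ vₙ` and `∑ vₙ ⊗ ξₙ` have
square `D`. By the zigzag equation `∑ ξₙ ⊗ vₙ` has inner product `N` with `η 1`, whereas `∑ vₙ ⊗ ξₙ`
has inner product `D` with `ε* 1`, so that `2 N ≤ ⟨η 1, η 1⟩ + D` and `2 D ≤ ⟨ε* 1, ε* 1⟩ + D`. -/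
theorem IsCentralOrthonormal.two_mul_card_le
    (hz : tensorMap η (𝟙 X) ≫ (assoc X Y X).hom ≫ tensorMap (𝟙 X) ε =
      (leftUnit X).hom ≫ (rightUnit X).inv)
    {ι : Type*} [Fintype ι] [DecidableEq ι] {ξ : ι → X} (hξ : IsCentralOrthonormal ξ) :
    ((2 * Fintype.card ι : ℕ) : A) ≤
      (tensor X Y).inner (Hom.lin η (toUnit 1)) (Hom.lin η (toUnit 1)) +
        (tensor Y X).inner (Hom.lin (dag ε) (toUnit 1)) (Hom.lin (dag ε) (toUnit 1)) := by
  set R := Hom.lin η (toUnit 1)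
  set e := Hom.lin (dag ε) (toUnit 1)
  set v : ι → Y := fun n => dualVec ε (hξ.mem_center n)
  set D : A := ∑ n, Y.inner (v n) (v n) with hD
  have hDstar : star D = D := by simp only [hD, star_sum, Y.star_inner]
  have hwR : (tensor X Y).inner (∑ n, tens (ξ n) (v n)) R = (Fintype.card ι : A) := by
    rw [map_sum, LinearMap.sum_apply, Finset.sum_congr rfl fun n _ =>
      (inner_tens_dualVec_of_zigzag hz (hξ.mem_center n) (ξ n)).trans (hξ.inner_self n),
      Finset.sum_const, Finset.card_univ, nsmul_one]
  have hRw : (tensor X Y).inner R (∑ n, tens (ξ n) (v n)) = (Fintype.card ι : A) := by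
    rw [← (tensor X Y).star_inner, hwR, star_natCast]
  have hez : (tensor Y X).inner e (∑ n, tens (v n) (ξ n)) = D := by
    rw [map_sum]
    refine Finset.sum_congr rfl fun n _ => ?_
    change toUnit _ = toUnit _
    rw [← lin_eq_inner_dag, inner_dualVec]
  have hze : (tensor Y X).inner (∑ n, tens (v n) (ξ n)) e = D := by
    rw [← (tensor Y X).star_inner, hez, hDstar]
  have hη := inner_add_inner_le R (∑ n, tens (ξ n) (v n))
  have hε := inner_add_inner_le e (∑ n, tens (v n) (ξ n))
  rw [hRw, hwR, hξ.inner_sum_tens_left, ← hD] at hη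
  rw [hez, hze, hξ.inner_sum_tens_right, ← hD, add_le_add_iff_right] at hε
  rw [Nat.cast_mul, Nat.cast_ofNat, two_mul]
  exact hη.trans (add_le_add_right hε _)

theorem exists_forall_card_le_of_zigzag [Nontrivial A]
    (hz : tensorMap η (𝟙 X) ≫ (assoc X Y X).hom ≫ tensorMap (𝟙 X) ε =
      (leftUnit X).hom ≫ (rightUnit X).inv) :
    ∃ N : ℕ, ∀ (n : ℕ) (ξ : Fin n → X), IsCentralOrthonormal ξ → n ≤ N := by
  obtain ⟨N, hN⟩ := exists_nat_ge
    ‖(tensor X Y).inner (Hom.lin η (toUnit 1)) (Hom.lin η (toUnit 1)) +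
      (tensor Y X).inner (Hom.lin (dag ε) (toUnit 1)) (Hom.lin (dag ε) (toUnit 1))‖
  refine ⟨N, fun n ξ hξ => ?_⟩
  have hn := (CStarAlgebra.norm_le_norm_of_nonneg_of_le (Nat.cast_nonneg' _)
    (hξ.two_mul_card_le hz)).trans hN
  rw [← map_natCast (algebraMap ℂ A), norm_algebraMap', Complex.norm_natCast, Fintype.card_fin,
    Nat.cast_le] at hn
  lia

end Duality

section ProjBasis
variable {A : Type} [CStarAlgebra A] [PartialOrder A] {X : FGCorr A} {n : ℕ} {b : Fin n → X}

theorem eq_of_forall_inner_basis_eq (hb : IsProjBasis X.ract X.inner b) {x y : X}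
    (h : ∀ i, X.inner (b i) x = X.inner (b i) y) : x = y := by
  rw [hb x, hb y]
  simp only [h]

theorem inner_eq_sum (hb : IsProjBasis X.ract X.inner b) (x y : X) :
    X.inner x y = ∑ i, X.inner x (b i) * X.inner (b i) y := by
  conv_lhs => rw [hb y, map_sum]
  exact Finset.sum_congr rfl fun i _ => X.inner_ract _ _ _

theorem inner_lact_eq_sum (hb : IsProjBasis X.ract X.inner b) (x y : X) (a : A) :
    X.inner x (X.lact a y) = ∑ i, X.inner x (X.lact a (b i)) * X.inner (b i) y := by
  rw [← star_star a, ← X.inner_lact, inner_eq_sum hb]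
  simp only [X.inner_lact]

variable [StarOrderedRing A]

theorem isProjBasis_of_forall_basis_eq (hb : IsProjBasis X.ract X.inner b) {k : ℕ} {ξ : Fin k → X}
    (hξ : ∀ j, b j = ∑ m, X.ract (op (X.inner (ξ m) (b j))) (ξ m)) :
    IsProjBasis X.ract X.inner ξ := fun x => by
  have hsum (m : Fin k) : X.inner (ξ m) x = ∑ j, X.inner (ξ m) (b j) * X.inner (b j) x :=
    inner_eq_sum hb _ _
  conv_lhs => rw [hb x]
  simp only [hsum, Finset.op_sum, map_sum, LinearMap.sum_apply, X.ract_mul_apply]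
  rw [Finset.sum_comm]
  refine Finset.sum_congr rfl fun j _ => ?_
  rw [← map_sum, ← hξ j]

end ProjBasis

section CentralBasis
variable {A : Type} [CStarAlgebra A] [PartialOrder A] [StarOrderedRing A] {X Y : FGCorr A}

/-- Projective bases that consist of orthonormal central vectors. -/
structure IsCentralBasis {k : ℕ} (ξ : Fin k → X) : Prop extends IsCentralOrthonormal ξ where
  isProjBasis : IsProjBasis X.ract X.inner ξ

theorem isCentralBasis_free (k : ℕ) :
    IsCentralBasis (X := free A k) fun i : Fin k => (Pi.single i (1 : A) : Fin k → A) where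
  mem_center n a := by
    refine funext fun i => ?_
    change a * (Pi.single n (1 : A) : Fin k → A) i = (Pi.single n (1 : A) : Fin k → A) i * a
    by_cases hi : i = n <;> simp [hi]
  inner_eq m n := by
    change freeInner k _ _ = _
    rw [freeInner_apply]
    simp only [Pi.single_apply, apply_ite star, star_one, star_zero, ite_mul, one_mul, zero_mul,
      Finset.sum_ite_eq', Finset.mem_univ, if_true]
  isProjBasis := free_basis k

theorem isCentralBasis_unit : IsCentralBasis (X := unit A) fun _ : Fin 1 => toUnit (1 : A) where
  mem_center _ _ := mem_commutant_toUnit.2 (by rw [mul_one, one_mul])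
  inner_eq m n := by
    rw [if_pos (Subsingleton.elim _ _)]
    exact (unitInner_apply 1 1).trans (by rw [star_one, one_mul])
  isProjBasis := unit_basis

namespace IsCentralBasis
variable {k : ℕ} {ξ : Fin k → X} {η : Fin k → Y} (h : IsCentralBasis ξ)

include h in
theorem hom_ext {f g : X ⟶ Y} (hfg : ∀ n, Hom.lin f (ξ n) = Hom.lin g (ξ n)) : f = g :=
  FGCorr.hom_ext fun x => by
    rw [h.isProjBasis x, map_sum, map_sum]
    exact Finset.sum_congr rfl fun n _ => by rw [lin_ract, lin_ract, hfg]

include h in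
protected theorem tens {l : ℕ} {ζ : Fin l → Y} (hζ : IsCentralBasis ζ) :
    IsCentralBasis fun m : Fin (k * l) =>
      FGCorr.tens (ξ (finProdFinEquiv.symm m).1) (ζ (finProdFinEquiv.symm m).2) where
  mem_center _ := tens_mem_center (h.mem_center _) (hζ.mem_center _)
  inner_eq m n := by
    rw [inner_tens, h.inner_eq]
    by_cases hmn : m = n
    · rw [hmn, if_pos rfl, if_pos rfl, map_one, Module.End.one_apply, hζ.inner_self]
    · rw [if_neg hmn]
      split_ifs with h₁
      · rw [map_one, Module.End.one_apply, hζ.inner_of_ne fun h₂ =>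
          hmn (finProdFinEquiv.symm.injective (Prod.ext h₁ h₂))]
      · rw [map_zero, LinearMap.zero_apply, map_zero]
  isProjBasis := Bal.basis h.isProjBasis hζ.isProjBasis

include h in
theorem tens_eq_sum {l : ℕ} {ζ : Fin l → Y} (hζ : IsCentralBasis ζ) (x : X) (y : Y) :
    FGCorr.tens x y = ∑ m, ∑ n, (tensor X Y).ract (op (X.inner (ξ m) x * Y.inner (ζ n) y))
      (FGCorr.tens (ξ m) (ζ n)) := by
  conv_lhs => rw [h.isProjBasis x, hζ.isProjBasis y]
  refine (sum_tmul _ _).trans (Finset.sum_congr rfl fun m _ => (tmul_sum _ _).trans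
    (Finset.sum_congr rfl fun n _ => ?_))
  exact tens_ract_of_mem_center (hζ.mem_center n) _ _ _

/-- The morphism that maps a central basis to given central vectors. -/
def desc (hη : ∀ n, η n ∈ center Y) : X ⟶ Y :=
  ∑ n, dag (ofCenter (h.mem_center n)) ≫ ofCenter (hη n)

theorem lin_desc (hη : ∀ n, η n ∈ center Y) (x : X) :
    Hom.lin (h.desc hη) x = ∑ n, Y.ract (op (X.inner (ξ n) x)) (η n) := by
  simp only [desc, lin_sum, lin_comp, lin_dag_ofCenter, lin_ofCenter, mem_center.1 (hη _)]

theorem lin_desc_basis (hη : ∀ n, η n ∈ center Y) (m : Fin k) :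
    Hom.lin (h.desc hη) (ξ m) = η m := by
  rw [lin_desc, Fintype.sum_eq_single m fun n hn => by
    rw [h.inner_of_ne hn, op_zero, map_zero, LinearMap.zero_apply],
    h.inner_self, op_one, map_one, Module.End.one_apply]

theorem dag_desc (hη : IsCentralBasis η) : dag (h.desc hη.mem_center) = hη.desc h.mem_center :=
  FGCorr.hom_ext fun y => ext_inner fun x => by
    rw [← inner_dag, lin_desc, lin_desc, LinearMap.map_sum₂, map_sum]
    refine Finset.sum_congr rfl fun n _ => ?_
    rw [X.inner_ract, inner_ract_left, X.star_inner]

/-- Correspondences with central bases of the same size are unitarily isomorphic. -/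
def iso (hη : IsCentralBasis η) : X ≅ Y where
  hom := h.desc hη.mem_center
  inv := hη.desc h.mem_center
  hom_inv_id := h.hom_ext fun n => by rw [lin_comp, lin_desc_basis, lin_desc_basis, lin_id]
  inv_hom_id := hη.hom_ext fun n => by rw [lin_comp, lin_desc_basis, lin_desc_basis, lin_id]

include h in
theorem sum_tens_mem_center : ∑ n, tens (ξ n) (ξ n) ∈ center (tensor X X) :=
  sum_mem fun n _ => tens_mem_center (h.mem_center n) (h.mem_center n)

/-- The coevaluation `1 ↦ ∑ ξ n ⊗ ξ n`. -/
def coev : unit A ⟶ tensor X X := ofCenter h.sum_tens_mem_center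

theorem lin_coev (a : A) : Hom.lin h.coev (toUnit a) = ∑ n, tens (X.lact a (ξ n)) (ξ n) := by
  rw [coev, lin_ofCenter, map_sum]
  simp only [lact_tens]

/-- The evaluation `x ⊗ y ↦ ∑ ⟨ξ n, x⟩ ⟨ξ n, y⟩`, which is the adjoint of the coevaluation. -/
def ev : tensor X X ⟶ unit A := dag h.coev

theorem lin_ev (x y : X) :
    Hom.lin h.ev (tens x y) = toUnit (∑ n, X.inner (ξ n) x * X.inner (ξ n) y) := by
  rw [ev, coev, lin_dag_ofCenter, LinearMap.map_sum₂]
  simp only [inner_tens, inner_lact_of_mem_center (h.mem_center _)]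

theorem lin_ev_basis_right (x : X) (m : Fin k) :
    Hom.lin h.ev (tens x (ξ m)) = toUnit (X.inner (ξ m) x) := by
  rw [lin_ev, Fintype.sum_eq_single m fun n hn => by rw [h.inner_of_ne hn, mul_zero], h.inner_self,
    mul_one]

theorem lin_ev_basis_left (x : X) (m : Fin k) :
    Hom.lin h.ev (tens (ξ m) x) = toUnit (X.inner (ξ m) x) := by
  rw [lin_ev, Fintype.sum_eq_single m fun n hn => by rw [h.inner_of_ne hn, zero_mul], h.inner_self,
    one_mul]

theorem lin_coev_ev (x : X) (a : A) :
    Hom.lin (leftUnit X).hom (Hom.lin (tensorMap h.ev (𝟙 X))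
      (Hom.lin (assoc X X X).inv (tens x (Hom.lin h.coev (toUnit a))))) = X.ract (op a) x := by
  have hterm (n : Fin k) : Hom.lin (leftUnit X).hom (Hom.lin (tensorMap h.ev (𝟙 X))
      (tens (tens x (X.lact a (ξ n))) (ξ n))) =
        X.ract (op a) (X.ract (op (X.inner (ξ n) x)) (ξ n)) := by
    rw [tensorMap_tens, mem_center.1 (h.mem_center n), ← ract_tens', lin_ract, lin_ev_basis_right,
      lin_id, ← X.ract_mul_apply]
    exact mem_center.1 (h.mem_center n) _
  rw [h.lin_coev, show tens x (∑ n, tens (X.lact a (ξ n)) (ξ n)) =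
    ∑ n, tens x (tens (X.lact a (ξ n)) (ξ n)) from tmul_sum _ _, map_sum, map_sum, map_sum]
  conv_rhs => rw [h.isProjBasis x, map_sum]
  exact Finset.sum_congr rfl fun n _ => hterm n

theorem lin_ev_coev (a : A) (x : X) :
    Hom.lin (rightUnit X).hom (Hom.lin (tensorMap (𝟙 X) h.ev)
      (Hom.lin (assoc X X X).hom (tens (Hom.lin h.coev (toUnit a)) x))) = X.lact a x := by
  rw [h.lin_coev, show tens (∑ n, tens (X.lact a (ξ n)) (ξ n)) x =
    ∑ n, tens (tens (X.lact a (ξ n)) (ξ n)) x from sum_tmul _ _, map_sum, map_sum, map_sum]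
  conv_rhs => rw [h.isProjBasis x, map_sum]
  refine Finset.sum_congr rfl fun n _ => ?_
  rw [assoc_hom_tens, tensorMap_tens, h.lin_ev_basis_left, lin_id, rightUnit_hom_tens, X.lact_ract]

/-- A correspondence with a central basis is its own dual. -/
@[reducible]
def exactPairing : ExactPairing X X where
  coevaluation' := h.coev
  evaluation' := h.ev
  coevaluation_evaluation' := by
    rw [Iso.eq_comp_inv]
    exact tensor_hom_ext (X := X) (Y := unit A) h.lin_coev_ev
  evaluation_coevaluation' := by
    rw [Iso.eq_comp_inv]
    exact tensor_hom_ext (X := unit A) (Y := X) h.lin_ev_coev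

end IsCentralBasis
end CentralBasis
end FGCorr

instance : Nontrivial LInf :=
  ⟨1, 0, fun h => by simpa only [vac_one, map_zero, one_ne_zero] using congrArg vac h⟩

section Localized
variable {X : FGCorr LInf} {p q : ℤ}

theorem isLocalized_lact {x : X} (hx : IsLocalized LInf.loc (Finset.Icc p q) x) {a : LInf}
    (ha : a ∈ LInf.loc (Finset.Icc p q)) : IsLocalized LInf.loc (Finset.Icc p q) (X.lact a x) :=
  fun c hc => by
    rw [← X.lact_mul_apply, complAlg_commute ha hc, X.lact_mul_apply, hx c hc, X.lact_ract]

theorem isLocalized_ract {x : X} (hx : IsLocalized LInf.loc (Finset.Icc p q) x) {a : LInf}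
    (ha : a ∈ LInf.loc (Finset.Icc p q)) :
    IsLocalized LInf.loc (Finset.Icc p q) (X.ract (op a) x) := fun c hc => by
  rw [X.lact_ract, hx c hc, ← X.ract_mul_apply, ← X.ract_mul_apply, complAlg_commute ha hc]

theorem isLocalized_sum {ι : Type*} (s : Finset ι) {x : ι → X} {I : Finset ℤ}
    (hx : ∀ i, IsLocalized LInf.loc I (x i)) : IsLocalized LInf.loc I (∑ i ∈ s, x i) :=
  fun c hc => by
    rw [map_sum, map_sum]
    exact Finset.sum_congr rfl fun i _ => hx i c hc

end Localized

section LocalRep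

open InnerProductSpace (rankOne)
open ContinuousLinearMap (adjoint)

variable {X : FGCorr LInf} {p q : ℤ} {n : ℕ} {b : Fin n → X}
  (hl : ∀ i, IsLocalized LInf.loc (Finset.Icc p q) (b i))

include hl in
theorem exists_embed_eq_inner_lact (i j : Fin n)
    (a : L2 (Finset.Icc p q → ℕ) →L[ℂ] L2 (Finset.Icc p q → ℕ)) :
    ∃ c, LInf.embed p q c = X.inner (b i) (X.lact (LInf.embed p q a) (b j)) :=
  mem_loc_Icc_iff.1 (inner_mem_loc (hl i) (isLocalized_lact (hl j) (mem_loc_Icc_iff.2 ⟨a, rfl⟩)))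

/-- The matrix coefficients `⟨b i, a (b j)⟩` of the left action of the local algebra, which are
local because the `b i` are localized. -/
def coef (i j : Fin n) : (L2 (Finset.Icc p q → ℕ) →L[ℂ] L2 (Finset.Icc p q → ℕ)) →ₗ[ℂ]
    L2 (Finset.Icc p q → ℕ) →L[ℂ] L2 (Finset.Icc p q → ℕ) :=
  have h := fun a => (exists_embed_eq_inner_lact hl i j a).choose_spec
  { toFun a := (exists_embed_eq_inner_lact hl i j a).choose
    map_add' a c := embed_injective p q ((h (a + c)).trans (by
      simp only [map_add, h, LinearMap.add_apply]))
    map_smul' z a := embed_injective p q ((h (z • a)).trans (by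
      simp only [map_smul, h, LinearMap.smul_apply, RingHom.id_apply])) }

theorem embed_coef (i j : Fin n) (a) : LInf.embed p q (coef hl i j a) =
    X.inner (b i) (X.lact (LInf.embed p q a) (b j)) :=
  (exists_embed_eq_inner_lact hl i j a).choose_spec

theorem embed_coef_one (i j : Fin n) : LInf.embed p q (coef hl i j 1) = X.inner (b i) (b j) := by
  rw [embed_coef, map_one, map_one, Module.End.one_apply]

theorem coef_mul (hb : IsProjBasis X.ract X.inner b) (i j : Fin n) (a c) :
    coef hl i j (a * c) = ∑ k, coef hl i k a * coef hl k j c :=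
  embed_injective p q (by
    simp only [map_sum, map_mul, embed_coef, Module.End.mul_apply]
    exact inner_lact_eq_sum hb _ _ _)

theorem star_coef (i j : Fin n) (a) : star (coef hl i j a) = coef hl j i (star a) :=
  embed_injective p q (by
    rw [map_star, embed_coef, embed_coef, X.star_inner, X.inner_lact, map_star (LInf.embed p q)])

/-- The Hilbert space `ℓ²(ℕ)^{⊗I} ⊗ ℂⁿ` for `I = [p, q]`. -/
abbrev AmplSpace (p q : ℤ) (n : ℕ) : Type := PiLp 2 fun _ : Fin n => L2 (Finset.Icc p q → ℕ)

/-- The representation of the local algebra on `ℓ²(ℕ)^{⊗I} ⊗ ℂⁿ` with the matrix coefficients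
`coef`. It is unital only if the basis `b` is orthonormal. -/
def localRep : (L2 (Finset.Icc p q → ℕ) →L[ℂ] L2 (Finset.Icc p q → ℕ)) →ₗ[ℂ]
    Module.End ℂ (AmplSpace p q n) where
  toFun a :=
    { toFun := fun v => WithLp.toLp 2 fun i => ∑ j, coef hl i j a (v j)
      map_add' := fun v w => by ext1 i; simp [Finset.sum_add_distrib]
      map_smul' := fun z v => by ext1 i; simp [Finset.smul_sum] }
  map_add' a c := by ext1 v; ext1 i; simp [Finset.sum_add_distrib]
  map_smul' z a := by ext1 v; ext1 i; simp [Finset.smul_sum]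

theorem localRep_apply (a) (v : AmplSpace p q n) (i : Fin n) :
    localRep hl a v i = ∑ j, coef hl i j a (v j) := rfl

variable (hb : IsProjBasis X.ract X.inner b)

include hb in
theorem isStarRep_localRep : IsStarRep (localRep hl) where
  map_mul a c := by
    ext1 v
    ext1 i
    simp only [localRep_apply, Module.End.mul_apply, coef_mul hl hb, sum_apply, map_sum,
      mul_apply_eq_comp]
    exact Finset.sum_comm
  inner_map a u v := by
    simp only [PiLp.inner_apply, localRep_apply, sum_inner, inner_sum]
    rw [Finset.sum_comm]
    refine Finset.sum_congr rfl fun i _ => Finset.sum_congr rfl fun j _ => ?_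
    rw [← star_coef, ContinuousLinearMap.star_eq_adjoint, ContinuousLinearMap.adjoint_inner_right]

variable (o : L2 (Finset.Icc p q → ℕ)) {v w : AmplSpace p q n}
  (hv : localRep hl (rankOne ℂ o o) v = v)

/-- The components of the intertwiner from `ℓ²(ℕ)^{⊗I}` to `ℓ²(ℕ)^{⊗I} ⊗ ℂⁿ` given by a vector in
the range of `π (|o⟩⟨o|)`. -/
def intertwinerCoord (i : Fin n) : L2 (Finset.Icc p q → ℕ) →L[ℂ] L2 (Finset.Icc p q → ℕ) :=
  (PiLp.proj 2 (fun _ : Fin n => L2 (Finset.Icc p q → ℕ)) i : _ →L[ℂ] _) ∘L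
    (isStarRep_localRep hl hb).intertwiner o hv

theorem sum_coef_mul_intertwinerCoord (i : Fin n) (a) :
    ∑ j, coef hl i j a * intertwinerCoord hl hb o hv j = intertwinerCoord hl hb o hv i * a := by
  ext1 h
  rw [sum_apply]
  exact congrArg (fun w : AmplSpace p q n => w i)
    ((isStarRep_localRep hl hb).map_intertwiner o hv a h)

theorem sum_star_intertwinerCoord_mul (hw : localRep hl (rankOne ℂ o o) w = w) :
    ∑ i, star (intertwinerCoord hl hb o hv i) * intertwinerCoord hl hb o hw i = ⟪v, w⟫_ℂ • 1 := by
  ext1 k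
  refine ext_inner_left ℂ fun h => ?_
  have hinner := (isStarRep_localRep hl hb).inner_intertwiner o hv hw h k
  rw [sum_apply, inner_sum, smul_apply, inner_smul_right, one_apply_eq_self, mul_comm, ← hinner,
    PiLp.inner_apply]
  refine Finset.sum_congr rfl fun i _ => ?_
  rw [mul_apply_eq_comp, ContinuousLinearMap.star_eq_adjoint,
    ContinuousLinearMap.adjoint_inner_right]
  rfl

theorem adjoint_intertwiner_single (j : Fin n) (h : L2 (Finset.Icc p q → ℕ)) :
    adjoint ((isStarRep_localRep hl hb).intertwiner o hv) (PiLp.single 2 j h) =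
      star (intertwinerCoord hl hb o hv j) h := by
  refine ext_inner_left ℂ fun g => ?_
  rw [ContinuousLinearMap.adjoint_inner_right, ContinuousLinearMap.star_eq_adjoint,
    ContinuousLinearMap.adjoint_inner_right, PiLp.inner_apply, Fintype.sum_eq_single j fun k hk =>
      by rw [PiLp.single_apply, if_neg hk, inner_zero_right], PiLp.single_apply, if_pos rfl]
  rfl

theorem localRep_single (i j : Fin n) (a) (h : L2 (Finset.Icc p q → ℕ)) :
    (localRep hl a (PiLp.single 2 j h) : AmplSpace p q n) i = coef hl i j a h := by
  rw [localRep_apply, Fintype.sum_eq_single j fun k hk => by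
    rw [PiLp.single_apply, if_neg hk, map_zero], PiLp.single_apply, if_pos rfl]

theorem coef_one_eq_sum (hpq : p ≤ q) (ho : ‖o‖ = 1) {ι : Type*} [Fintype ι]
    {v : ι → AmplSpace p q n} (hv : ∀ m, localRep hl (rankOne ℂ o o) (v m) = v m)
    (hspan : ∀ u, localRep hl (rankOne ℂ o o) u = u → u = ∑ m, ⟪v m, u⟫_ℂ • v m) (i j : Fin n) :
    coef hl i j 1 =
      ∑ m, intertwinerCoord hl hb o (hv m) i * star (intertwinerCoord hl hb o (hv m) j) := by
  have : Nonempty (Finset.Icc p q) := ⟨⟨p, Finset.mem_Icc.2 ⟨le_rfl, hpq⟩⟩⟩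
  have : TopologicalSpace.SeparableSpace (L2 (Finset.Icc p q → ℕ)) := separableSpace_L2 _
  have : SecondCountableTopology (L2 (Finset.Icc p q → ℕ)) :=
    UniformSpace.secondCountable_of_separable _
  ext1 h
  rw [← localRep_single, (isStarRep_localRep hl hb).map_one_eq_sum ho hv hspan, WithLp.ofLp_sum,
    Finset.sum_apply, sum_apply]
  exact Finset.sum_congr rfl fun m _ => by rw [adjoint_intertwiner_single]; rfl

/-- The central vector `∑ b i Tᵢ`, where the `Tᵢ` are the components of the intertwiner given by a
vector in the range of `π (|o⟩⟨o|)`. -/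
def centralVec : X := ∑ i, X.ract (op (LInf.embed p q (intertwinerCoord hl hb o hv i))) (b i)

theorem inner_lact_centralVec (i : Fin n) (a) :
    X.inner (b i) (X.lact (LInf.embed p q a) (centralVec hl hb o hv)) =
      LInf.embed p q (intertwinerCoord hl hb o hv i * a) := by
  rw [← sum_coef_mul_intertwinerCoord, centralVec, map_sum, map_sum, map_sum]
  refine Finset.sum_congr rfl fun j _ => ?_
  rw [X.lact_ract, X.inner_ract, map_mul, embed_coef]

theorem inner_basis_centralVec (i : Fin n) :
    X.inner (b i) (centralVec hl hb o hv) = LInf.embed p q (intertwinerCoord hl hb o hv i) := by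
  have h := inner_lact_centralVec hl hb o hv i 1
  rwa [map_one, map_one, mul_one] at h

theorem inner_centralVec_basis (i : Fin n) : X.inner (centralVec hl hb o hv) (b i) =
    LInf.embed p q (star (intertwinerCoord hl hb o hv i)) := by
  rw [← X.star_inner, inner_basis_centralVec, map_star]

theorem centralVec_mem_center : centralVec hl hb o hv ∈ center X := by
  have hloc : IsLocalized LInf.loc (Finset.Icc p q) (centralVec hl hb o hv) :=
    isLocalized_sum _ fun i => isLocalized_ract (hl i) (mem_loc_Icc_iff.2 ⟨_, rfl⟩)
  refine mem_commutant_of_isLocalized hloc fun c hc => ?_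
  obtain ⟨a, rfl⟩ := mem_loc_Icc_iff.1 hc
  refine eq_of_forall_inner_basis_eq hb fun i => ?_
  rw [inner_lact_centralVec, X.inner_ract, inner_basis_centralVec, map_mul]

theorem inner_centralVec_centralVec (hw : localRep hl (rankOne ℂ o o) w = w) :
    X.inner (centralVec hl hb o hv) (centralVec hl hb o hw) = ⟪v, w⟫_ℂ • 1 := by
  rw [inner_eq_sum hb]
  simp only [inner_basis_centralVec, inner_centralVec_basis, ← map_mul]
  rw [← map_sum, sum_star_intertwinerCoord_mul, map_smul, map_one]

theorem isCentralOrthonormal_centralVec {k : ℕ} {v : Fin k → AmplSpace p q n}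
    (hv : ∀ m, localRep hl (rankOne ℂ o o) (v m) = v m) (hon : Orthonormal ℂ v) :
    IsCentralOrthonormal fun m => centralVec hl hb o (hv m) where
  mem_center m := centralVec_mem_center hl hb o (hv m)
  inner_eq m m' := by
    rw [inner_centralVec_centralVec, orthonormal_iff_ite.1 hon, ite_smul, one_smul, zero_smul]

theorem isProjBasis_centralVec (hpq : p ≤ q) (ho : ‖o‖ = 1) {k : ℕ}
    {v : Fin k → AmplSpace p q n} (hv : ∀ m, localRep hl (rankOne ℂ o o) (v m) = v m)
    (hspan : ∀ u, localRep hl (rankOne ℂ o o) u = u → u = ∑ m, ⟪v m, u⟫_ℂ • v m) :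
    IsProjBasis X.ract X.inner fun m => centralVec hl hb o (hv m) :=
  isProjBasis_of_forall_basis_eq hb fun j => eq_of_forall_inner_basis_eq hb fun i => by
    rw [← embed_coef_one hl, coef_one_eq_sum hl hb o hpq ho hv hspan, map_sum, map_sum]
    refine Finset.sum_congr rfl fun m _ => ?_
    rw [X.inner_ract, inner_basis_centralVec, inner_centralVec_basis, map_mul]

include hb in
theorem finiteDimensional_of_forall_card_le {C : ℕ}
    (hC : ∀ (N : ℕ) (ξ : Fin N → X), IsCentralOrthonormal ξ → N ≤ C) :
    FiniteDimensional ℂ (LinearMap.eqLocus (localRep hl (rankOne ℂ o o)) LinearMap.id) := by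
  refine Module.rank_lt_aleph0_iff.1 ((rank_le (n := C) fun s hs => ?_).trans_lt
    Cardinal.natCast_lt_aleph0)
  let B := stdOrthonormalBasis ℂ (Submodule.span ℂ (s : Set (LinearMap.eqLocus
    (localRep hl (rankOne ℂ o o)) LinearMap.id)))
  rw [← finrank_span_finset_eq_card hs]
  exact hC _ _ (isCentralOrthonormal_centralVec hl hb o (fun m => (B m).1.2)
    (B.orthonormal.comp_linearIsometry ((Submodule.subtypeₗᵢ _).comp (Submodule.subtypeₗᵢ _))))

include hl hb in
theorem exists_isCentralBasis_of_forall_card_le (hpq : p ≤ q) {C : ℕ}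
    (hC : ∀ (N : ℕ) (ξ : Fin N → X), IsCentralOrthonormal ξ → N ≤ C) :
    ∃ (k : ℕ) (ξ : Fin k → X), IsCentralBasis ξ := by
  let o : L2 (Finset.Icc p q → ℕ) := ket 0
  have := finiteDimensional_of_forall_card_le hl hb o hC
  let B := stdOrthonormalBasis ℂ (LinearMap.eqLocus (localRep hl (rankOne ℂ o o)) LinearMap.id)
  refine ⟨_, _, isCentralOrthonormal_centralVec hl hb o (fun m => (B m).2)
    (B.orthonormal.comp_linearIsometry (Submodule.subtypeₗᵢ _)),
    isProjBasis_centralVec hl hb o hpq (norm_ket _) _ fun u hu => ?_⟩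
  simpa using congrArg Subtype.val (B.sum_repr' ⟨u, hu⟩).symm

end LocalRep

namespace FGCorr
section CentralSpace

theorem inner_eq_vac_smul_one {X : FGCorr LInf} {ξ η : X} (hξ : ξ ∈ center X) (hη : η ∈ center X) :
    X.inner ξ η = vac (X.inner ξ η) • 1 :=
  eq_vac_smul_one_of_central fun b => commute_inner (hξ (star b)) (hη b)

variable (X : FGCorr LInf)

/-- The Hilbert space structure on the central vectors: their inner products in `LInf` are scalars,
which `vac` reads off. -/
@[reducible]
def centerInnerCore : InnerProductSpace.Core ℂ (center X) where
  inner ξ η := vac (X.inner ξ η)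
  conj_inner_symm ξ η := by
    change star (vac (X.inner η ξ)) = vac (X.inner ξ η)
    rw [← vac_star, X.star_inner]
  re_inner_nonneg ξ := by
    obtain ⟨c, hc⟩ := CStarAlgebra.nonneg_iff_eq_star_mul_self.1 (X.inner_self_nonneg ξ)
    change 0 ≤ (vac (X.inner ξ ξ)).re
    rw [hc]
    exact vac_star_mul_self_nonneg c
  add_left ξ ξ' η := by
    change vac (X.inner (ξ + ξ' : X) η) = _
    rw [map_add, LinearMap.add_apply, map_add]
  smul_left ξ η z := by
    change vac (X.inner (z • ξ : X) η) = _
    rw [map_smulₛₗ, LinearMap.smul_apply, map_smul]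
    rfl
  definite ξ hξ := by
    change vac (X.inner ξ ξ) = 0 at hξ
    refine Subtype.ext (X.inner_self_eq_zero _ ?_)
    rw [inner_eq_vac_smul_one ξ.2 ξ.2, hξ, zero_smul]

instance : NormedAddCommGroup (center X) := (centerInnerCore X).toNormedAddCommGroup
instance : InnerProductSpace ℂ (center X) := InnerProductSpace.ofCore (centerInnerCore X).toCore

variable {X} {Y : FGCorr LInf}

theorem inner_center_def (ξ η : center X) : ⟪ξ, η⟫_ℂ = vac (X.inner ξ η) := rfl

theorem inner_eq_inner_smul_one (ξ η : center X) : X.inner ξ η = ⟪ξ, η⟫_ℂ • 1 :=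
  inner_eq_vac_smul_one ξ.2 η.2

namespace IsCentralBasis
variable {k l : ℕ} {ξ : Fin k → X} {η : Fin l → Y} (h : IsCentralBasis ξ)

include h in
theorem eq_sum_inner_smul (ζ : center X) :
    ζ = ∑ n, ⟪(⟨ξ n, h.mem_center n⟩ : center X), ζ⟫_ℂ • (⟨ξ n, h.mem_center n⟩ : center X) := by
  refine Subtype.ext ((h.isProjBasis ζ).trans ?_)
  rw [Submodule.coe_sum]
  refine Finset.sum_congr rfl fun n _ => ?_
  rw [inner_eq_inner_smul_one ⟨ξ n, h.mem_center n⟩ ζ, X.ract_smul_apply, op_one, map_one]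
  rfl

/-- A central basis, as an orthonormal basis of the Hilbert space of central vectors. -/
def orthonormalBasis : OrthonormalBasis (Fin k) ℂ (center X) :=
  OrthonormalBasis.mk (v := fun n => ⟨ξ n, h.mem_center n⟩)
    (orthonormal_iff_ite.2 fun m n => by
      rw [inner_center_def, h.inner_eq, apply_ite vac, vac_one, map_zero])
    fun ζ _ => by
      rw [h.eq_sum_inner_smul ζ]
      exact sum_mem fun n _ => Submodule.smul_mem _ _ (Submodule.subset_span ⟨n, rfl⟩)

theorem orthonormalBasis_apply (n : Fin k) : h.orthonormalBasis n = ⟨ξ n, h.mem_center n⟩ :=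
  congrFun (OrthonormalBasis.coe_mk _ _) n

end IsCentralBasis

/-- The restriction of a morphism to the central vectors. -/
def centerMap (f : X ⟶ Y) : center X →ₗ[ℂ] center Y :=
  (Hom.lin f).restrict fun _ hξ => lin_mem_center f hξ

theorem inner_centerMap_dag (f : X ⟶ Y) (η : center Y) (ξ : center X) :
    ⟪centerMap (dag f) η, ξ⟫_ℂ = ⟪η, centerMap f ξ⟫_ℂ := by
  rw [← inner_conj_symm, ← inner_conj_symm η]
  exact congrArg (fun a => starRingEnd ℂ (vac a)) (inner_dag f (ξ : X) (η : Y)).symm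

theorem IsCentralBasis.exists_centerMap_eq {k : ℕ} {ξ : Fin k → X} (h : IsCentralBasis ξ)
    (φ : center X →ₗ[ℂ] center Y) : ∃ f : X ⟶ Y, centerMap f = φ := by
  refine ⟨h.desc (η := fun n => φ ⟨ξ n, h.mem_center n⟩) fun n => (φ _).2,
    h.orthonormalBasis.toBasis.ext fun n => ?_⟩
  rw [OrthonormalBasis.coe_toBasis, h.orthonormalBasis_apply]
  exact Subtype.ext (h.lin_desc_basis _ n)

variable (X Y) in
/-- The map `ξ ⊗ η ↦ ξ ⊗ η` from the tensor product of the spaces of central vectors. -/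
def centerTens : center X ⊗[ℂ] center Y →ₗ[ℂ] center (tensor X Y) :=
  TensorProduct.lift (LinearMap.mk₂ ℂ
    (fun ξ η => ⟨tens (ξ : X) (η : Y), tens_mem_center ξ.2 η.2⟩)
    (fun ξ ξ' η => Subtype.ext (add_tens (ξ : X) ξ' (η : Y)))
    (fun z ξ η => Subtype.ext (smul_tens z (ξ : X) (η : Y)))
    (fun ξ η η' => Subtype.ext (tens_add (ξ : X) (η : Y) η'))
    (fun z ξ η => Subtype.ext (tens_smul z (ξ : X) (η : Y))))

theorem centerTens_tmul (ξ : center X) (η : center Y) :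
    (centerTens X Y (ξ ⊗ₜ η) : tensor X Y) = tens (ξ : X) (η : Y) := rfl

theorem inner_centerTens (s t : center X ⊗[ℂ] center Y) :
    ⟪centerTens X Y s, centerTens X Y t⟫_ℂ = ⟪s, t⟫_ℂ := by
  induction s with
  | zero => rw [map_zero, inner_zero_left, inner_zero_left]
  | add s s' hs hs' => rw [map_add, inner_add_left, inner_add_left, hs, hs']
  | tmul ξ η =>
    induction t with
    | zero => rw [map_zero, inner_zero_right, inner_zero_right]
    | add t t' ht ht' => rw [map_add, inner_add_right, inner_add_right, ht, ht']
    | tmul ξ' η' =>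
      rw [TensorProduct.inner_tmul, inner_center_def, centerTens_tmul, centerTens_tmul, inner_tens,
        inner_eq_inner_smul_one, lact_smul_apply, map_one, map_smul, map_smul]
      rfl

theorem centerTens_surjective {k l : ℕ} {ξ : Fin k → X} {η : Fin l → Y} (hξ : IsCentralBasis ξ)
    (hη : IsCentralBasis η) : Function.Surjective (centerTens X Y) := by
  rw [← LinearMap.range_eq_top, eq_top_iff, ← (hξ.tens hη).orthonormalBasis.toBasis.span_eq,
    Submodule.span_le]
  rintro _ ⟨m, rfl⟩
  rw [OrthonormalBasis.coe_toBasis, (hξ.tens hη).orthonormalBasis_apply]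
  exact ⟨(⟨_, hξ.mem_center (finProdFinEquiv.symm m).1⟩ : center X) ⊗ₜ
    (⟨_, hη.mem_center (finProdFinEquiv.symm m).2⟩ : center Y), rfl⟩

variable (X Y) in
/-- The isometry `ξ ⊗ η ↦ ξ ⊗ η` between Hilbert spaces of central vectors. -/
def centerTensIsometry : center X ⊗[ℂ] center Y →ₗᵢ[ℂ] center (tensor X Y) :=
  (centerTens X Y).isometryOfInner inner_centerTens

/-- The unitary `z ↦ z • 1` from `ℂ` to the central vectors of the unit correspondence. -/
def centerUnitEquiv : ℂ ≃ₗᵢ[ℂ] center (unit LInf) :=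
  LinearIsometryEquiv.ofSurjective (LinearMap.isometryOfInner
    (LinearMap.toSpanSingleton ℂ _ (⟨toUnit 1, isCentralBasis_unit.mem_center 0⟩ :
      center (unit LInf))) fun z w => by
    simp only [LinearMap.toSpanSingleton_apply, inner_smul_left, inner_smul_right,
      inner_center_def, isCentralBasis_unit.inner_self 0, vac_one]
    rw [mul_one]; rfl)
    fun ζ => ⟨_, by
      have h := isCentralBasis_unit.eq_sum_inner_smul ζ
      rw [Fin.sum_univ_one] at h
      exact h.symm⟩

end CentralSpace
end FGCorr

open MonoidalCategory

section Equivalence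

theorem exists_isCentralBasis (X : DHR₀ LInf.loc) :
    ∃ (k : ℕ) (ξ : Fin k → X.corr), IsCentralBasis ξ := by
  obtain ⟨Y, ⟨hY⟩⟩ := X.property.1
  obtain ⟨R, hR⟩ := X.obj.property
  obtain ⟨n, b, hb, hl⟩ := hR 1 (R + 1) (by simp)
  obtain ⟨C, hC⟩ := exists_forall_card_le_of_zigzag (X := X.corr) (Y := Y.obj)
    (congrArg (·.hom) (ExactPairing.evaluation_coevaluation X.obj Y))
  exact exists_isCentralBasis_of_forall_card_le hl hb (by lia) hC

instance (X : DHR₀ LInf.loc) : FiniteDimensional ℂ (center X.corr) := by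
  obtain ⟨k, ξ, h⟩ := exists_isCentralBasis X
  exact h.orthonormalBasis.toBasis.finiteDimensional_of_finite

/-- The functor that maps a DHR bimodule to its Hilbert space of central vectors. -/
def centerFunctor : DHR₀ LInf.loc ⥤ HilbFd where
  obj X := ⟨center X.corr⟩
  map f := centerMap f.hom.hom

instance : centerFunctor.Faithful where
  map_injective {X Y f g} hfg := by
    obtain ⟨k, ξ, h⟩ := exists_isCentralBasis X
    refine ObjectProperty.hom_ext _ (ObjectProperty.hom_ext _ (h.hom_ext fun n => ?_))
    exact congrArg Subtype.val (LinearMap.congr_fun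
      (show centerMap f.hom.hom = centerMap g.hom.hom from hfg) ⟨ξ n, h.mem_center n⟩)

instance : centerFunctor.Full where
  map_surjective {X Y} φ := by
    obtain ⟨k, ξ, h⟩ := exists_isCentralBasis X
    obtain ⟨f, hf⟩ := h.exists_centerMap_eq (Y := Y.corr) (HilbFd.lin φ)
    exact ⟨ObjectProperty.homMk (ObjectProperty.homMk f), hf⟩

theorem isDHR_of_isCentralBasis {X : FGCorr LInf} {k : ℕ} {ξ : Fin k → X} (h : IsCentralBasis ξ) :
    IsDHR LInf.loc X :=
  ⟨0, fun _ _ _ => ⟨k, ξ, h.isProjBasis, fun n a _ => h.mem_center n a⟩⟩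

theorem isDualizable_of_isCentralBasis {X : DHR LInf.loc} {k : ℕ} {ξ : Fin k → X.obj}
    (h : IsCentralBasis ξ) : IsDualizable LInf.loc X := by
  let : ExactPairing ((IsDHR LInf.loc).ι.obj X) ((IsDHR LInf.loc).ι.obj X) := h.exactPairing
  have := ExactPairing.ofFullyFaithful (IsDHR LInf.loc).ι X X
  exact ⟨⟨X, ⟨this⟩⟩, ⟨X, ⟨this⟩⟩⟩

/-- The free correspondence of rank `k`, as a dualizable DHR bimodule. -/
def freeDHR (k : ℕ) : DHR₀ LInf.loc :=
  ⟨⟨free LInf k, isDHR_of_isCentralBasis (isCentralBasis_free k)⟩,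
    isDualizable_of_isCentralBasis (isCentralBasis_free k)⟩

instance : centerFunctor.EssSurj where
  mem_essImage E :=
    ⟨freeDHR (Module.finrank ℂ E), ⟨HilbFd.isoMk
      (E := centerFunctor.obj (freeDHR (Module.finrank ℂ E)))
      ((isCentralBasis_free _).orthonormalBasis.toBasis.equiv (Module.finBasis ℂ E)
        (Equiv.refl _))⟩⟩

instance : centerFunctor.IsEquivalence where

instance : centerFunctor.Additive where
  map_add := rfl

instance : centerFunctor.Linear ℂ where
  map_smul _ _ := rfl

/-- The unitary `ξ ⊗ η ↦ ξ ⊗ η`, which is the tensorator of `centerFunctor`. -/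
def centerTensEquiv (X Y : DHR₀ LInf.loc) :
    center X.corr ⊗[ℂ] center Y.corr ≃ₗᵢ[ℂ] center (tensor X.corr Y.corr) :=
  LinearIsometryEquiv.ofSurjective (centerTensIsometry X.corr Y.corr) <| by
    obtain ⟨k, ξ, hξ⟩ := exists_isCentralBasis X
    obtain ⟨l, η, hη⟩ := exists_isCentralBasis Y
    exact centerTens_surjective hξ hη

/-- The tensor structure of `centerFunctor`. -/
def centerCoreMonoidal : centerFunctor.CoreMonoidal where
  εIso := HilbFd.isoMk (E := 𝟙_ HilbFd) (F := centerFunctor.obj (𝟙_ _))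
    centerUnitEquiv.toLinearEquiv
  μIso X Y := HilbFd.isoMk (E := centerFunctor.obj X ⊗ centerFunctor.obj Y)
    (F := centerFunctor.obj (X ⊗ Y)) (centerTensEquiv X Y).toLinearEquiv
  μIso_hom_natural_left _ _ := TensorProduct.ext' fun _ _ => rfl
  μIso_hom_natural_right _ _ := TensorProduct.ext' fun _ _ => rfl
  associativity _ _ _ := TensorProduct.ext_threefold fun _ _ _ => rfl
  left_unitality _ := TensorProduct.ext' fun z ξ => Subtype.ext (smul_eq_lact z ξ.1)
  right_unitality _ := TensorProduct.ext' fun ξ z => Subtype.ext (smul_eq_ract z ξ.1)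

instance : centerFunctor.Monoidal := centerCoreMonoidal.toMonoidal

open Functor.LaxMonoidal Functor.OplaxMonoidal

theorem HilbFd.dagger_eq {E F : HilbFd} {f : E ⟶ F} {g : F ⟶ E}
    (h : ∀ x y, ⟪HilbFd.lin g x, y⟫_ℂ = ⟪x, HilbFd.lin f y⟫_ℂ) : DaggerCategory.dagger f = g :=
  ((LinearMap.eq_adjoint_iff (HilbFd.lin g) (HilbFd.lin f)).2 h).symm

theorem isUnitaryTensorFunctor_centerFunctor : IsUnitaryTensorFunctor centerFunctor where
  map_dagger {X Y} f := (HilbFd.dagger_eq (E := centerFunctor.obj X) (F := centerFunctor.obj Y)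
    (f := centerFunctor.map f) (g := centerFunctor.map (DaggerCategory.dagger f))
    (inner_centerMap_dag f.hom.hom)).symm
  dagger_μ X Y := HilbFd.dagger_eq (E := centerFunctor.obj X ⊗ centerFunctor.obj Y)
    (F := centerFunctor.obj (X ⊗ Y)) (f := μ centerFunctor X Y) (g := δ centerFunctor X Y)
    (centerTensEquiv X Y).symm.inner_map_eq_flip
  dagger_ε := HilbFd.dagger_eq (E := 𝟙_ HilbFd) (F := centerFunctor.obj (𝟙_ _))
    (f := ε centerFunctor) (g := η centerFunctor) centerUnitEquiv.symm.inner_map_eq_flip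

/-- The braiding transported from finite-dimensional Hilbert spaces along `centerFunctor`. -/
instance : BraidedCategory (DHR₀ LInf.loc) := BraidedCategory.ofFullyFaithful centerFunctor

instance : centerFunctor.Braided where
  braided X Y := by
    change μ centerFunctor X Y ≫ centerFunctor.map (centerFunctor.preimage
      (δ centerFunctor X Y ≫ (β_ (centerFunctor.obj X) (centerFunctor.obj Y)).hom ≫
        μ centerFunctor Y X)) = _
    rw [Functor.map_preimage, Functor.Monoidal.μ_δ_assoc]

theorem lin_braiding_tens_of_mem_center {X Y : DHR₀ LInf.loc} {ξ : X.corr} {η : Y.corr}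
    (hξ : ξ ∈ center X.corr) (hη : η ∈ center Y.corr) :
    Hom.lin (β_ X Y).hom.hom.hom (tens ξ η) = tens η ξ :=
  congrArg Subtype.val (LinearMap.congr_fun
    (show (centerMap (β_ X Y).hom.hom.hom) ∘ₗ centerTens X.corr Y.corr =
      centerTens Y.corr X.corr ∘ₗ (TensorProduct.comm ℂ _ _).toLinearMap from
        Functor.LaxBraided.braided (F := centerFunctor) X Y)
    ((⟨ξ, hξ⟩ : center X.corr) ⊗ₜ (⟨η, hη⟩ : center Y.corr)))

theorem lin_tens_eq_of_isLocalized {X Y : FGCorr LInf} {k l : ℕ} {ξ : Fin k → X} {η : Fin l → Y}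
    (hξ : IsCentralBasis ξ) (hη : IsCentralBasis η) {f : tensor X Y ⟶ tensor Y X}
    (hf : ∀ m n, Hom.lin f (tens (ξ m) (η n)) = tens (η n) (ξ m)) {p q r s : ℤ}
    (hdisj : Disjoint (Finset.Icc p q) (Finset.Icc r s)) {x : X} {y : Y}
    (hx : IsLocalized LInf.loc (Finset.Icc p q) x) (hy : IsLocalized LInf.loc (Finset.Icc r s) y) :
    Hom.lin f (tens x y) = tens y x := by
  -- The coefficients of `x` and `y` in the central bases lie in commuting local algebras.
  have hcomm (m n) : X.inner (ξ m) x * Y.inner (η n) y = Y.inner (η n) y * X.inner (ξ m) x :=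
    commute_of_mem_loc_Icc hdisj (inner_mem_loc (fun a _ => hξ.mem_center m a) hx)
      (inner_mem_loc (fun a _ => hη.mem_center n a) hy)
  have hxy : tens x y = ∑ m, ∑ n, (tensor X Y).ract (op (X.inner (ξ m) x * Y.inner (η n) y))
      (tens (ξ m) (η n)) := hξ.tens_eq_sum hη x y
  have hyx : tens y x = ∑ m, ∑ n, (tensor Y X).ract (op (X.inner (ξ m) x * Y.inner (η n) y))
      (tens (η n) (ξ m)) := by
    rw [hη.tens_eq_sum hξ, Finset.sum_comm]
    simp only [hcomm]
  rw [hxy, hyx]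
  simp only [map_sum, lin_ract, hf]

theorem isDHRBraiding_LInf : IsDHRBraiding LInf.loc := by
  intro X Y
  refine ⟨0, fun p q r s hpq x y hx hy => ?_⟩
  obtain ⟨k, ξ, hξ⟩ := exists_isCentralBasis X
  obtain ⟨l, η, hη⟩ := exists_isCentralBasis Y
  exact lin_tens_eq_of_isLocalized hξ hη
    (fun m n => lin_braiding_tens_of_mem_center (hξ.mem_center m) (hη.mem_center n))
    (Finset.disjoint_left.2 fun i hi hj => by simpa using hpq i hi i hj) hx hy

end Equivalence

end RotorChain
end

theorem mainTheorem8 :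
    (∀ X : RotorChain.DHR₀ RotorChain.LInf.loc,
      ∃ (k : ℕ) (u : X.corr ≅ RotorChain.FGCorr.free RotorChain.LInf k),
        RotorChain.DaggerCategory.dagger u.hom = u.inv) ∧
    ∃ (_ : CategoryTheory.BraidedCategory (RotorChain.DHR₀ RotorChain.LInf.loc))
      (F : RotorChain.DHR₀ RotorChain.LInf.loc ⥤ RotorChain.HilbFd) (_ : F.Braided),
      RotorChain.IsDHRBraiding RotorChain.LInf.loc ∧ F.IsEquivalence ∧ F.Additive ∧ F.Linear ℂ ∧
        RotorChain.IsUnitaryTensorFunctor F := by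
  refine ⟨fun X => ?_, inferInstance, RotorChain.centerFunctor, inferInstance,
    RotorChain.isDHRBraiding_LInf, inferInstance, inferInstance, inferInstance,
    RotorChain.isUnitaryTensorFunctor_centerFunctor⟩
  obtain ⟨k, ξ, h⟩ := RotorChain.exists_isCentralBasis X
  exact ⟨k, h.iso (RotorChain.FGCorr.isCentralBasis_free k),
    h.dag_desc (RotorChain.FGCorr.isCentralBasis_free k)⟩
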